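/- Let $L$ be a link that is not splittable, that is, no diagram of $L$ consists of two non-empty link diagrams lying apart from each other. A $\mathbb{Z}$-coloring of a diagram $D$ of $L$ is a map $\gamma$ from the set of arcs of $D$ to $\mathbb{Z}$ with $2\gamma(a)=\gamma(b)+\gamma(c)$ at each crossing with over arc $a$ and under arcs $b,c$; it is non-trivial if it takes at least two values. The link $L$ is $\mathbb{Z}$-colorable if some diagram of $L$ has a non-trivial $\mathbb{Z}$-coloring, and then $\mathrm{mincol}_{\mathbb{Z}}(L)$ is the minimum of the number of values $|\mathrm{Im}(\gamma)|$ over all non-trivial $\mathbb{Z}$-colorings $\gamma$ of all diagrams of $L$. A non-trivial $\mathbb{Z}$-coloring $\gamma$ of $D$ is simple if there is a natural number $d$ such that at every crossing of $D$, with over arc $a$ and under arcs $b,c$, both $|\gamma(a)-\gamma(b)|$ and $|\gamma(a)-\gamma(c)|$ lie in $\{0,d\}$. Theorem. Let $L$ be a non-splittable $\mathbb{Z}$-colorable link. If some diagram of $L$ has a simple $\mathbb{Z}$-coloring, then $\mathrm{mincol}_{\mathbb{Z}}(L)=4$. -/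

import Mathlib

namespace ZColoring

/-! ### Link diagrams

An unoriented link diagram in the plane, in general position with respect to the height function,
is recorded by reading it from bottom to top: it is a finite sequence of slices, each of which
contains exactly one local minimum, local maximum or crossing, and otherwise vertical strands.
Every regular link diagram is carried to such a position by a planar isotopy, which changes
neither its arcs nor its crossings. -/

/-- What a slice contains besides vertical strands: a local minimum `cup`, a local maximum `cap`,
or a crossing of two strands. In `cross true` the strand that runs from the bottom left to the top
right is the over strand, in `cross false` it is the under strand. -/
inductive Piece : Type
  | cup
  | cap
  | cross (b : Bool)

/-- The number of strands that enter a piece from below. -/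
def Piece.ins : Piece → ℕ
  | .cup => 0
  | .cap => 2
  | .cross _ => 2

/-- The number of strands that leave a piece at the top. -/
def Piece.outs : Piece → ℕ
  | .cup => 2
  | .cap => 0
  | .cross _ => 2

/-- A slice: a piece with `pos` vertical strands to its left. The number of vertical strands to
its right is determined by the number of strands that enter the slice. -/
structure Slice : Type where
  piece : Piece
  pos : ℕ

/-- The sequence `w` of slices fits together, starting from `m` strands below it and ending with
`n` strands above it. -/
def Fits : List Slice → ℕ → ℕ → Prop
  | [], m, n => m = n
  | s :: w, m, n =>
      s.pos + s.piece.ins ≤ m ∧ Fits w (m - s.piece.ins + s.piece.outs) n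

/-- The number of strands above the sequence `w` of slices, if it starts from `m` strands. -/
def strandsAfter : List Slice → ℕ → ℕ
  | [], m => m
  | s :: w, m => strandsAfter w (m - s.piece.ins + s.piece.outs)

/-- A link diagram: a sequence of slices that fits together, without loose ends below or above.
The empty sequence is the diagram of the empty link. -/
structure Diagram : Type where
  slices : List Slice
  fits : Fits slices 0 0

/-! ### Links: diagrams up to planar isotopy and Reidemeister moves -/

/-- The local moves on sequences of slices. -/
inductive Move : List Slice → List Slice → Prop
  /-- planar isotopy: two pieces beside each other (`a` on the left, `b` on the right, `k` strands
  between them) exchange their heights -/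
  | exchange (a b : Piece) (i k : ℕ) :
      Move [⟨a, i⟩, ⟨b, i + a.outs + k⟩] [⟨b, i + a.ins + k⟩, ⟨a, i⟩]
  /-- planar isotopy: an adjacent minimum and maximum on a strand cancel -/
  | zigzag_left (i : ℕ) : Move [⟨.cup, i⟩, ⟨.cap, i + 1⟩] []
  | zigzag_right (i : ℕ) : Move [⟨.cup, i + 1⟩, ⟨.cap, i⟩] []
  /-- planar isotopy: a crossing slides over a maximum from one side to the other -/
  | slide_cap (b : Bool) (i : ℕ) :
      Move [⟨.cross b, i⟩, ⟨.cap, i + 1⟩] [⟨.cross (!b), i + 1⟩, ⟨.cap, i⟩]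
  /-- planar isotopy: a crossing slides through a minimum from one side to the other -/
  | slide_cup (b : Bool) (i : ℕ) :
      Move [⟨.cup, i⟩, ⟨.cross b, i + 1⟩] [⟨.cup, i + 1⟩, ⟨.cross (!b), i⟩]
  /-- Reidemeister move I, at a maximum and at a minimum -/
  | reidemeister_one_cap (b : Bool) (i : ℕ) : Move [⟨.cross b, i⟩, ⟨.cap, i⟩] [⟨.cap, i⟩]
  | reidemeister_one_cup (b : Bool) (i : ℕ) : Move [⟨.cup, i⟩, ⟨.cross b, i⟩] [⟨.cup, i⟩]
  /-- Reidemeister move II -/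
  | reidemeister_two (b : Bool) (i : ℕ) : Move [⟨.cross b, i⟩, ⟨.cross (!b), i⟩] []
  /-- Reidemeister move III for strands A, B, C (at the bottom, from left to right): `p` says that
  A is over B, `q` that A is over C, and `r` that B is over C. The condition says that the three
  strands lie at three levels, one above the other: A over B over C over A is excluded, and so is
  the reverse. -/
  | reidemeister_three (p q r : Bool) (i : ℕ) (h : p = r → q = p) :
      Move [⟨.cross p, i⟩, ⟨.cross q, i + 1⟩, ⟨.cross r, i⟩]
        [⟨.cross r, i + 1⟩, ⟨.cross q, i⟩, ⟨.cross p, i + 1⟩]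

/-- `E` arises from `D` by one local move. -/
def Diagram.Step (D E : Diagram) : Prop :=
  ∃ u v x y : List Slice, Move x y ∧ D.slices = u ++ x ++ v ∧ E.slices = u ++ y ++ v

/-- Two diagrams are equivalent if they are related by finitely many local moves and inverses of
local moves. -/
def Diagram.equivalence : Setoid Diagram :=
  Relation.EqvGen.setoid Diagram.Step

/-- A link (up to isotopy) is a diagram up to planar isotopy and Reidemeister moves. -/
def Link : Type := Quotient Diagram.equivalence

/-- The link that a diagram represents. -/
def Diagram.link (D : Diagram) : Link := Quotient.mk Diagram.equivalence D

/-- A link is splittable if it has a diagram that consists of two non-empty link diagrams lying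
apart from each other, the second one above the first one. -/
def Link.IsSplittable (L : Link) : Prop :=
  ∃ D D₁ D₂ : Diagram, D.link = L ∧ D₁.slices ≠ [] ∧ D₂.slices ≠ [] ∧
    D.slices = D₁.slices ++ D₂.slices

/-! ### Arcs and crossings -/

namespace Diagram

/-- The points of the diagram at the heights between the slices: `(k, j)` is the point in which
the strand number `j` (from the left, starting with `0`) meets the horizontal line above the first
`k` slices. -/
def Point (D : Diagram) : Type :=
  {x : ℕ × ℕ // x.1 ≤ D.slices.length ∧ x.2 < strandsAfter (D.slices.take x.1) 0}

/-- The points `x` and `y` are the ends of a piece of strand inside one slice that does not pass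
under another strand. -/
inductive Joined (D : Diagram) : D.Point → D.Point → Prop
  /-- a vertical strand to the left of the piece -/
  | left (k j : ℕ) (s : Slice) (x y : D.Point) (hs : D.slices[k]? = some s) (hj : j < s.pos)
      (hx : x.1 = (k, j)) (hy : y.1 = (k + 1, j)) : Joined D x y
  /-- a vertical strand to the right of the piece -/
  | right (k j : ℕ) (s : Slice) (x y : D.Point) (hs : D.slices[k]? = some s)
      (hx : x.1 = (k, s.pos + s.piece.ins + j))
      (hy : y.1 = (k + 1, s.pos + s.piece.outs + j)) : Joined D x y
  | cup (k i : ℕ) (x y : D.Point) (hs : D.slices[k]? = some ⟨.cup, i⟩)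
      (hx : x.1 = (k + 1, i)) (hy : y.1 = (k + 1, i + 1)) : Joined D x y
  | cap (k i : ℕ) (x y : D.Point) (hs : D.slices[k]? = some ⟨.cap, i⟩)
      (hx : x.1 = (k, i)) (hy : y.1 = (k, i + 1)) : Joined D x y
  /-- the over strand of a crossing -/
  | over_true (k i : ℕ) (x y : D.Point) (hs : D.slices[k]? = some ⟨.cross true, i⟩)
      (hx : x.1 = (k, i)) (hy : y.1 = (k + 1, i + 1)) : Joined D x y
  | over_false (k i : ℕ) (x y : D.Point) (hs : D.slices[k]? = some ⟨.cross false, i⟩)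
      (hx : x.1 = (k, i + 1)) (hy : y.1 = (k + 1, i)) : Joined D x y

/-- An arc of the diagram: a maximal piece of strand that does not pass under another strand,
given as the class of the points on it. -/
def Arc (D : Diagram) : Type := Quotient (Relation.EqvGen.setoid D.Joined)

/-- The arc through a point. -/
def arc (D : Diagram) (x : D.Point) : D.Arc := Quotient.mk _ x

/-- There is a crossing of `D` with over arc `a` and under arcs `b` and `c`. -/
def IsCrossing (D : Diagram) (a b c : D.Arc) : Prop :=
  ∃ (k i : ℕ) (x y z : D.Point), a = D.arc x ∧ b = D.arc y ∧ c = D.arc z ∧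
    ((D.slices[k]? = some ⟨.cross true, i⟩ ∧
        x.1 = (k, i) ∧ y.1 = (k, i + 1) ∧ z.1 = (k + 1, i)) ∨
      (D.slices[k]? = some ⟨.cross false, i⟩ ∧
        x.1 = (k, i + 1) ∧ y.1 = (k, i) ∧ z.1 = (k + 1, i + 1)))

/-! ### Colorings by integers -/

/-- `γ` is a `ℤ`-coloring of `D`. -/
def IsColoring (D : Diagram) (γ : D.Arc → ℤ) : Prop :=
  ∀ a b c : D.Arc, D.IsCrossing a b c → 2 * γ a = γ b + γ c

/-- `γ` is a `ℤ`-coloring of `D` that does not assign the same color to all arcs. -/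
def IsNontrivialColoring (D : Diagram) (γ : D.Arc → ℤ) : Prop :=
  D.IsColoring γ ∧ ∃ a b : D.Arc, γ a ≠ γ b

/-- `γ` is a simple `ℤ`-coloring of `D`: it is non-trivial, and for one natural number `d`, the
colors of the over arc and of each of the under arcs differ by `d` or `0` at all crossings. -/
def IsSimpleColoring (D : Diagram) (γ : D.Arc → ℤ) : Prop :=
  D.IsNontrivialColoring γ ∧ ∃ d : ℕ, ∀ a b c : D.Arc, D.IsCrossing a b c →
    (|γ a - γ b| = d ∨ |γ a - γ b| = 0) ∧ (|γ a - γ c| = d ∨ |γ a - γ c| = 0)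

end Diagram

/-- A link is `ℤ`-colorable if it has a diagram with a non-trivial `ℤ`-coloring. -/
def Link.IsZColorable (L : Link) : Prop :=
  ∃ D : Diagram, D.link = L ∧ ∃ γ : D.Arc → ℤ, D.IsNontrivialColoring γ

/-- The minimal coloring number of a `ℤ`-colorable link: the least number of colors of the
non-trivial `ℤ`-colorings of its diagrams (the value is `0`, and without meaning, if the link is
not `ℤ`-colorable). -/
noncomputable def Link.mincol (L : Link) : ℕ :=
  sInf {n : ℕ | ∃ D : Diagram, D.link = L ∧
    ∃ γ : D.Arc → ℤ, D.IsNontrivialColoring γ ∧ n = (Set.range γ).ncard}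

end ZColoring

namespace ZColoring

/-! ### Words of slices up to isotopy -/

/-! The proof rests on a criterion for splitting (`Chain.isSplittable`). Suppose that the strands of
a diagram fall into two classes, both present, and that at every crossing between the classes the
over strand is in the first and both under arcs are in the second. Then the first class can be
lifted off the second, so the link is splittable.

Lower bound (`four_le_ncard`). Since $2\gamma(a)=\gamma(b)+\gamma(c)$, an over arc of least or
greatest colour forces all three arcs at the crossing to have that colour. With two colours every
crossing is therefore monochromatic. With three colours the arcs of the middle colour pass over all
others. In both cases the criterion splits the link.

Upper bound. By the criterion the colours of a simple colouring are congruent modulo $d$, so after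
translation and division they lie in $0,\dots,n$ and differ by at most $1$ at a crossing
(`exists_isSimple_word`). It remains to remove the colour $n$ while $n\ge 4$
(`exists_isSimple_pred`). An over arc of colour $n$ has only the colour $n$ under it. So if no arc
of colour $n$ ends under an arc of another colour, the strands of colour $n$ meet no others and
either are absent or split off. Otherwise there is a crossing with over arc $n-1$ and under arcs $n$
and $n-2$. Its over arc is pushed as a finger along the strand of colour $n$ (`hasLighter_push`).
Passing under an arc of colour $c$ reflects a colour $x$ to $2c-x$, so the covered strand gets the
colour $2(n-1)-n=n-2$. At a maximum or at a crossing with the colour $n$ only, the finger passes on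
and removes a piece of weight $3$. At a crossing under another arc of colour $n-1$, the remaining
segment of colour $n$ is bounded by two such crossings. A curl of colour $n-2$ laid over both
reflects it to $2(n-2)-n=n-4\ge 0$. Each time the weight, which measures how often $n$ occurs,
drops.

Isotopies are carried out on words of slices with free ends, colourings on words whose slices carry
lists of colours (`Chain`). `Diagram.exists_colored_word` and `Chain.exists_coloring` translate
between these and colourings of arcs. -/

theorem fits_append {u v : List Slice} {m n : ℕ} :
    Fits (u ++ v) m n ↔ ∃ k, Fits u m k ∧ Fits v k n := by
  induction u generalizing m with
  | nil => simp [Fits]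
  | cons s u ih => simp [Fits, ih, and_assoc]

theorem Fits.append {u v : List Slice} {m k n : ℕ} (hu : Fits u m k) (hv : Fits v k n) :
    Fits (u ++ v) m n :=
  fits_append.2 ⟨k, hu, hv⟩

theorem Fits.top_unique {w : List Slice} {m n n' : ℕ} (h : Fits w m n) (h' : Fits w m n') :
    n = n' := by
  induction w generalizing m with
  | nil => exact h.symm.trans h'
  | cons s w ih => exact ih h.2 h'.2

theorem Fits.bottom_unique {w : List Slice} {m m' n : ℕ} (h : Fits w m n) (h' : Fits w m' n) :
    m = m' := by
  induction w generalizing m m' with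
  | nil => exact h.trans h'.symm
  | cons s w ih =>
    have h1 := ih h.2 h'.2
    have h2 := h.1
    have h3 := h'.1
    omega

/-- Isotopy of tangle diagrams with `m` ends below and `n` ends above. -/
inductive Isotopic : ℕ → ℕ → List Slice → List Slice → Prop
  | refl {m n : ℕ} {w : List Slice} (h : Fits w m n) : Isotopic m n w w
  | move {m n : ℕ} {x y : List Slice} (h : Move x y) (hx : Fits x m n) (hy : Fits y m n) :
      Isotopic m n x y
  | symm {m n : ℕ} {x y : List Slice} (h : Isotopic m n x y) : Isotopic m n y x
  | trans {m n : ℕ} {x y z : List Slice} (h : Isotopic m n x y) (h' : Isotopic m n y z) :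
      Isotopic m n x z
  | append {m k n : ℕ} {x y x' y' : List Slice} (h : Isotopic m k x y)
      (h' : Isotopic k n x' y') : Isotopic m n (x ++ x') (y ++ y')

theorem Isotopic.fits {m n : ℕ} {x y : List Slice} (h : Isotopic m n x y) :
    Fits x m n ∧ Fits y m n := by
  induction h with
  | refl h => exact ⟨h, h⟩
  | move _ hx hy => exact ⟨hx, hy⟩
  | symm _ ih => exact ih.symm
  | trans _ _ ih ih' => exact ⟨ih.1, ih'.2⟩
  | append _ _ ih ih' => exact ⟨ih.1.append ih'.1, ih.2.append ih'.2⟩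

/-- Isotopic words stay isotopic in a context. -/
theorem Isotopic.context {k l m n : ℕ} {x y : List Slice} (u v : List Slice)
    (h : Isotopic k l x y) (hu : Fits u m k) (hv : Fits v l n) :
    Isotopic m n (u ++ (x ++ v)) (u ++ (y ++ v)) :=
  (Isotopic.refl hu).append (h.append (.refl hv))

/-- The widths at the two ends of the replaced piece are determined by the context, so it suffices
that both full words fit. -/
theorem Isotopic.step {m n : ℕ} {x y : List Slice} (u v : List Slice) (h : Move x y)
    (hw : Fits (u ++ (x ++ v)) m n) (hw' : Fits (u ++ (y ++ v)) m n) :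
    Isotopic m n (u ++ (x ++ v)) (u ++ (y ++ v)) := by
  obtain ⟨k, hu, hxv⟩ := fits_append.1 hw
  obtain ⟨l, hx, hv⟩ := fits_append.1 hxv
  obtain ⟨k', hu', hyv⟩ := fits_append.1 hw'
  obtain ⟨l', hy, hv'⟩ := fits_append.1 hyv
  obtain rfl := hu.top_unique hu'
  obtain rfl := hv.bottom_unique hv'
  exact (Isotopic.move h hx hy).context u v hu hv

/-- Words that are isotopic by an isotopy of narrower tangles are isotopic in the given width. -/
theorem Isotopic.context' {k l m n : ℕ} {x y : List Slice} (u v : List Slice)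
    (h : Isotopic k l x y) (hu : Fits u m k) (hw : Fits (u ++ (x ++ v)) m n) :
    Isotopic m n (u ++ (x ++ v)) (u ++ (y ++ v)) := by
  obtain ⟨k', hu', hxv⟩ := fits_append.1 hw
  obtain rfl := hu.top_unique hu'
  obtain ⟨l', hx, hv⟩ := fits_append.1 hxv
  obtain rfl := hx.top_unique h.fits.1
  exact h.context u v hu hv

/-- The exchange move with free positions under linear conditions, so that the gap between the
pieces need not be exhibited. -/
theorem Move.far {a b : Piece} {i j j' : ℕ} (h : i + a.ins ≤ j') (hj : j + a.ins = j' + a.outs) :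
    Move [⟨a, i⟩, ⟨b, j⟩] [⟨b, j'⟩, ⟨a, i⟩] := by
  have := Move.exchange a b i (j' - (i + a.ins))
  rwa [show i + a.outs + (j' - (i + a.ins)) = j by omega,
    show i + a.ins + (j' - (i + a.ins)) = j' by omega] at this

/-- The intermediate words of an isotopy fit between the same ends, so a context that closes one of
them up closes all of them to diagrams. Quantifying over contexts lets the `append` case change one
factor while the other belongs to the context. -/
theorem Isotopic.link_eq_of_context {k l : ℕ} {x y : List Slice} (h : Isotopic k l x y) :
    ∀ (u v : List Slice) (_ : Fits u 0 k) (_ : Fits v l 0) (D E : Diagram),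
      D.slices = u ++ (x ++ v) → E.slices = u ++ (y ++ v) → D.link = E.link := by
  induction h with
  | refl h =>
    intro u v _ _ D E hD hE
    have : D = E := by
      cases D; cases E; simp_all
    rw [this]
  | move h hx hy =>
    intro u v _ _ D E hD hE
    exact Quotient.sound (Relation.EqvGen.rel _ _ ⟨u, v, _, _, h, by simp [hD], by simp [hE]⟩)
  | symm _ ih =>
    intro u v hu hv D E hD hE
    exact (ih u v hu hv E D hE hD).symm
  | trans h h' ih ih' =>
    intro u v hu hv D E hD hE
    let M : Diagram := ⟨_, hu.append (h.fits.2.append hv)⟩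
    exact (ih u v hu hv D M hD rfl).trans (ih' u v hu hv M E rfl hE)
  | @append _ _ _ x y x' y' h h' ih ih' =>
    intro u v hu hv D E hD hE
    let M : Diagram := ⟨_, hu.append (h.fits.2.append (h'.fits.1.append hv))⟩
    refine (ih u (x' ++ v) hu (h'.fits.1.append hv) D M (by simp [hD]) rfl).trans
      (ih' (u ++ y) v (hu.append h.fits.2) hv M E (by simp [M]) (by simp [hE]))

theorem Isotopic.link_eq {D E : Diagram} (h : Isotopic 0 0 D.slices E.slices) :
    D.link = E.link :=
  h.link_eq_of_context [] [] rfl rfl D E (by simp) (by simp)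

/-! ### Shifting words to the right -/

/-- The word `w` with `k` more vertical strands to its left. -/
def shift (k : ℕ) (w : List Slice) : List Slice :=
  w.map fun s => ⟨s.piece, k + s.pos⟩

@[simp] theorem shift_nil (k : ℕ) : shift k [] = [] := rfl

@[simp] theorem shift_cons (k : ℕ) (s : Slice) (w : List Slice) :
    shift k (s :: w) = ⟨s.piece, k + s.pos⟩ :: shift k w := rfl

@[simp] theorem shift_append (k : ℕ) (u v : List Slice) :
    shift k (u ++ v) = shift k u ++ shift k v := List.map_append

theorem shift_shift (k l : ℕ) (w : List Slice) : shift k (shift l w) = shift (k + l) w := by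
  simp [shift, Function.comp_def, add_assoc]

@[simp] theorem shift_zero (w : List Slice) : shift 0 w = w := by
  simp [shift]

theorem Fits.shift {w : List Slice} {m n : ℕ} (h : Fits w m n) (k : ℕ) :
    Fits (shift k w) (k + m) (k + n) := by
  induction w generalizing m with
  | nil => exact congrArg (k + ·) h
  | cons s w ih =>
    refine ⟨?_, ?_⟩
    · have := h.1
      dsimp only
      omega
    · have h1 := ih h.2
      have h2 := h.1
      dsimp only
      rwa [show k + m - s.piece.ins + s.piece.outs = k + (m - s.piece.ins + s.piece.outs) by omega]

theorem Move.shift {x y : List Slice} (h : Move x y) (k : ℕ) :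
    Move (shift k x) (shift k y) := by
  cases h with
  | exchange a b i j =>
    simp only [shift_cons, shift_nil]
    exact .far (by omega) (by omega)
  | zigzag_left i => exact .zigzag_left (k + i)
  | zigzag_right i => exact .zigzag_right (k + i)
  | slide_cap b i => exact .slide_cap b (k + i)
  | slide_cup b i => exact .slide_cup b (k + i)
  | reidemeister_one_cap b i => exact .reidemeister_one_cap b (k + i)
  | reidemeister_one_cup b i => exact .reidemeister_one_cup b (k + i)
  | reidemeister_two b i => exact .reidemeister_two b (k + i)
  | reidemeister_three p q r i h => exact .reidemeister_three p q r (k + i) h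

theorem Isotopic.shift {m n : ℕ} {x y : List Slice} (h : Isotopic m n x y) (k : ℕ) :
    Isotopic (k + m) (k + n) (shift k x) (shift k y) := by
  induction h with
  | refl h => exact .refl (h.shift k)
  | move h hx hy => exact .move (h.shift k) (hx.shift k) (hy.shift k)
  | symm _ ih => exact ih.symm
  | trans _ _ ih ih' => exact ih.trans ih'
  | append _ _ ih ih' => simpa using ih.append ih'

/-- A slice moves up past a word on its right. -/
theorem isotopic_cons_shift (a : Piece) (i : ℕ) (w : List Slice) {m n : ℕ}
    (h : Fits (⟨a, i⟩ :: shift (i + a.outs) w) m n) :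
    Isotopic m n (⟨a, i⟩ :: shift (i + a.outs) w) (shift (i + a.ins) w ++ [⟨a, i⟩]) := by
  induction w generalizing m with
  | nil => exact .refl h
  | cons s w ih =>
    simp only [shift_cons, Fits] at h
    obtain ⟨h1, h2, h3⟩ := h
    have e : m - a.ins + a.outs - s.piece.ins + s.piece.outs =
        m - s.piece.ins + s.piece.outs - a.ins + a.outs := by omega
    have hw := ih (m := m - s.piece.ins + s.piece.outs) ⟨by dsimp only; omega, by rwa [e] at h3⟩
    have hs : Fits [⟨s.piece, i + a.ins + s.pos⟩] m (m - s.piece.ins + s.piece.outs) :=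
      ⟨by dsimp only; omega, rfl⟩
    refine .trans (.step [] _ (.far (j' := i + a.ins + s.pos) (by omega) (by omega)) ?_ ?_)
      ((Isotopic.refl hs).append hw)
    · exact ⟨h1, h2, h3⟩
    · exact hs.append hw.fits.1

/-- A slice moves down past crossings on its left. -/
theorem isotopic_append_slice (b : Piece) (j : ℕ) (w : List Slice)
    (hw : ∀ s ∈ w, ∃ c, s.piece = .cross c ∧ s.pos + 2 ≤ j) {m n : ℕ}
    (h : Fits (⟨b, j⟩ :: w) m n) :
    Isotopic m n (w ++ [⟨b, j⟩]) (⟨b, j⟩ :: w) := by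
  induction w generalizing m with
  | nil => exact .refl h
  | cons s w ih =>
    obtain ⟨c, hc, hj⟩ := hw s (by simp)
    obtain ⟨p, i⟩ := s
    simp only at hc hj
    subst hc
    obtain ⟨h1, h2, h3⟩ := h
    change j + b.ins ≤ m at h1
    change i + 2 ≤ m - b.ins + b.outs at h2
    change Fits w (m - b.ins + b.outs - 2 + 2) n at h3
    have e : m - b.ins + b.outs - 2 + 2 = m - 2 + 2 - b.ins + b.outs := by omega
    have hw' := ih (fun s hs => hw s (by simp [hs])) (m := m - 2 + 2)
      ⟨by dsimp only; omega, by rwa [e] at h3⟩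
    have hs : Fits [⟨.cross c, i⟩] m (m - 2 + 2) := ⟨by simp only [Piece.ins]; omega, rfl⟩
    refine .trans ((Isotopic.refl hs).append hw')
      (.step [] w (.far (j' := j) (by simpa [Piece.ins] using hj) rfl) ?_ ?_)
    · exact hs.append hw'.fits.2
    · exact ⟨h1, h2, h3⟩

/-! ### Turning words upside down -/

/-- A piece upside down. -/
def Piece.flip : Piece → Piece
  | .cup => .cap
  | .cap => .cup
  | .cross b => .cross (!b)

@[simp] theorem Piece.flip_ins (p : Piece) : p.flip.ins = p.outs := by cases p <;> rfl

@[simp] theorem Piece.flip_outs (p : Piece) : p.flip.outs = p.ins := by cases p <;> rfl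

@[simp] theorem Piece.flip_flip (p : Piece) : p.flip.flip = p := by cases p <;> simp [Piece.flip]

/-- A word upside down. -/
def flipWord (w : List Slice) : List Slice :=
  (w.map fun s => ⟨s.piece.flip, s.pos⟩).reverse

@[simp] theorem flipWord_append (u v : List Slice) :
    flipWord (u ++ v) = flipWord v ++ flipWord u := by
  simp [flipWord]

@[simp] theorem flipWord_flipWord (w : List Slice) : flipWord (flipWord w) = w := by
  simp [flipWord, Function.comp_def]

theorem Fits.flip {w : List Slice} {m n : ℕ} (h : Fits w m n) : Fits (flipWord w) n m := by
  induction w generalizing m with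
  | nil => exact h.symm
  | cons s w ih =>
    obtain ⟨h1, h2⟩ := h
    have : flipWord (s :: w) = flipWord w ++ [⟨s.piece.flip, s.pos⟩] := by simp [flipWord]
    rw [this]
    refine (ih h2).append ⟨?_, ?_⟩
    · simp only [Piece.flip_ins]
      omega
    · simp only [Piece.flip_ins, Piece.flip_outs, Fits]
      omega

/-- The exchange and slide moves are reversed by turning them upside down, which is why either
direction is allowed. -/
theorem Move.flip {x y : List Slice} (h : Move x y) :
    Move (flipWord x) (flipWord y) ∨ Move (flipWord y) (flipWord x) := by
  cases h with
  | exchange a b i j =>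
    right
    exact .far (by simp) (by simp; omega)
  | zigzag_left i => exact .inl (.zigzag_right i)
  | zigzag_right i => exact .inl (.zigzag_left i)
  | slide_cap b i =>
    right
    simpa [flipWord, Piece.flip] using Move.slide_cup b i
  | slide_cup b i =>
    right
    simpa [flipWord, Piece.flip] using Move.slide_cap b i
  | reidemeister_one_cap b i => exact .inl (.reidemeister_one_cup (!b) i)
  | reidemeister_one_cup b i => exact .inl (.reidemeister_one_cap (!b) i)
  | reidemeister_two b i =>
    left
    simpa [flipWord, Piece.flip] using Move.reidemeister_two b i
  | reidemeister_three p q r i h =>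
    left
    simpa [flipWord, Piece.flip] using
      Move.reidemeister_three (!r) (!q) (!p) i (by revert h; cases p <;> cases q <;> cases r <;> simp)

theorem Isotopic.flip {m n : ℕ} {x y : List Slice} (h : Isotopic m n x y) :
    Isotopic n m (flipWord x) (flipWord y) := by
  induction h with
  | refl h => exact .refl h.flip
  | move h hx hy =>
    obtain h | h := h.flip
    · exact .move h hx.flip hy.flip
    · exact (Isotopic.move h hy.flip hx.flip).symm
  | symm _ ih => exact ih.symm
  | trans _ _ ih ih' => exact ih.trans ih'
  | append _ _ ih ih' => simpa using ih'.append ih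

/-! ### Shuffles: strands labelled `true` pass over strands labelled `false` -/

/-- The strand number `k` passes under the `k` strands to its left. -/
def pass : ℕ → List Slice
  | 0 => []
  | k + 1 => ⟨.cross true, k⟩ :: pass k

/-- The braid that starts with all strands labelled `true` on the left of all strands labelled
`false` and ends with the labels `c`, in which the former pass over the latter. -/
def shuffle : List Bool → List Slice
  | [] => []
  | true :: c => shift 1 (shuffle c)
  | false :: c => pass (c.count true) ++ shift 1 (shuffle c)

theorem fits_cons {p : Piece} {i m n : ℕ} {w : List Slice} (h : i + p.ins ≤ m)
    (hw : Fits w (m - p.ins + p.outs) n) : Fits (⟨p, i⟩ :: w) m n := ⟨h, hw⟩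

theorem fits_single {p : Piece} {i m n : ℕ} (h : i + p.ins ≤ m) (hn : n = m - p.ins + p.outs) :
    Fits [⟨p, i⟩] m n := ⟨h, hn.symm⟩

theorem fits_cross_cons {b : Bool} {i m n : ℕ} {w : List Slice} (h : i + 2 ≤ m)
    (hw : Fits w m n) : Fits (⟨.cross b, i⟩ :: w) m n := by
  refine ⟨h, ?_⟩
  simpa [Piece.ins, Piece.outs, show m - 2 + 2 = m by omega] using hw

theorem fits_pass {k m : ℕ} (h : k + 1 ≤ m) : Fits (pass k) m m := by
  induction k with
  | zero => rfl
  | succ k ih =>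
    exact fits_cross_cons h (ih (by omega))

theorem fits_shuffle (c : List Bool) : Fits (shuffle c) c.length c.length := by
  induction c with
  | nil => rfl
  | cons x c ih =>
    have h := ih.shift 1
    rw [add_comm 1] at h
    cases x
    · refine .append (fits_pass ?_) h
      have := c.count_le_length (a := true)
      simp only [List.length_cons]
      omega
    · exact h

theorem pass_succ (k : ℕ) : pass (k + 1) = shift 1 (pass k) ++ [⟨.cross true, 0⟩] := by
  induction k with
  | zero => rfl
  | succ k ih =>
    conv_lhs => rw [pass, ih]
    conv_rhs => rw [pass]
    simp [add_comm]

theorem pass_spec {k j : ℕ} (h : k + 1 ≤ j) :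
    ∀ s ∈ pass k, ∃ c, s.piece = .cross c ∧ s.pos + 2 ≤ j := by
  induction k with
  | zero => simp [pass]
  | succ k ih =>
    intro s hs
    obtain rfl | hs := List.mem_cons.1 hs
    · exact ⟨true, rfl, by dsimp only; omega⟩
    · exact ih (by omega) s hs

/-- The word in which the strand in position `q + s.ins` passes under the strands that enter the
piece `s`. -/
def passUnder : Piece → ℕ → List Slice
  | .cup, _ => []
  | _, q => [⟨.cross true, q + 1⟩, ⟨.cross true, q⟩]

/-- The word in which the strand in position `q` passes over the strands that enter the
piece `s`. -/
def passOver : Piece → ℕ → List Slice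
  | .cup, _ => []
  | _, q => [⟨.cross true, q⟩, ⟨.cross true, q + 1⟩]

/-- At a minimum or maximum this is a slide followed by the second Reidemeister move. At a crossing
it is the third, which is available for both values of `b` because the moving strand is the lowest
of the three. The word `passUnder` depends only on the number of entering strands, so `s.flip`
stands for the strands that leave `s`. -/
theorem isotopic_passUnder (s : Piece) (q m : ℕ) (h : q + s.ins + 1 ≤ m) :
    Isotopic m (m - s.ins + s.outs) (passUnder s q ++ [⟨s, q + 1⟩])
      (⟨s, q⟩ :: passUnder s.flip q) := by
  cases s with
  | cup =>
    simp only [Piece.ins, Piece.outs] at h ⊢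
    have h1 : Isotopic m (m - 0 + 2) [⟨.cup, q⟩, ⟨.cross true, q + 1⟩, ⟨.cross true, q⟩]
        [⟨.cup, q + 1⟩, ⟨.cross false, q⟩, ⟨.cross true, q⟩] :=
      .step [] [⟨.cross true, q⟩] (.slide_cup true q)
        (by simp [Fits, Piece.ins, Piece.outs]; omega)
        (by simp [Fits, Piece.ins, Piece.outs]; omega)
    have h2 : Isotopic m (m - 0 + 2) [⟨.cup, q + 1⟩, ⟨.cross false, q⟩, ⟨.cross true, q⟩]
        [⟨.cup, q + 1⟩] :=
      .step [⟨.cup, q + 1⟩] [] (.reidemeister_two false q)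
        (by simp [Fits, Piece.ins, Piece.outs]; omega)
        (by simp [Fits, Piece.ins, Piece.outs]; omega)
    exact (h1.trans h2).symm
  | cap =>
    simp only [Piece.ins, Piece.outs] at h ⊢
    have h1 : Isotopic m (m - 2 + 0) [⟨.cross true, q + 1⟩, ⟨.cross true, q⟩, ⟨.cap, q + 1⟩]
        [⟨.cross true, q + 1⟩, ⟨.cross false, q + 1⟩, ⟨.cap, q⟩] :=
      .step [⟨.cross true, q + 1⟩] [] (.slide_cap true q)
        (by simp [Fits, Piece.ins, Piece.outs]; omega)
        (by simp [Fits, Piece.ins, Piece.outs]; omega)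
    have h2 : Isotopic m (m - 2 + 0) [⟨.cross true, q + 1⟩, ⟨.cross false, q + 1⟩, ⟨.cap, q⟩]
        [⟨.cap, q⟩] :=
      .step [] [⟨.cap, q⟩] (.reidemeister_two true (q + 1))
        (by simp [Fits, Piece.ins, Piece.outs]; omega)
        (by simp [Fits, Piece.ins, Piece.outs]; omega)
    exact h1.trans h2
  | cross b =>
    simp only [Piece.ins, Piece.outs] at h ⊢
    refine (Isotopic.move (.reidemeister_three b true true q ?_) ?_ ?_).symm.trans ?_
    · exact fun h => h.symm
    · simp [Fits, Piece.ins, Piece.outs]; omega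
    · simp [Fits, Piece.ins, Piece.outs]; omega
    · exact .refl (fits_cross_cons (by omega) (fits_cross_cons (by omega)
        (fits_cross_cons (by omega) (by simp only [Fits]; omega))))

/-- The counterpart of `isotopic_passUnder` for a strand moving from left to right: it is now the
highest of the three. -/
theorem isotopic_passOver (s : Piece) (q m : ℕ) (h : q + s.ins + 1 ≤ m) :
    Isotopic m (m - s.ins + s.outs) (passOver s q ++ [⟨s, q⟩])
      (⟨s, q + 1⟩ :: passOver s.flip q) := by
  cases s with
  | cup =>
    simp only [Piece.ins, Piece.outs] at h ⊢
    have h1 : Isotopic m (m - 0 + 2) [⟨.cup, q⟩, ⟨.cross false, q + 1⟩, ⟨.cross true, q + 1⟩]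
        [⟨.cup, q + 1⟩, ⟨.cross true, q⟩, ⟨.cross true, q + 1⟩] :=
      .step [] [⟨.cross true, q + 1⟩] (.slide_cup false q)
        (by simp [Fits, Piece.ins, Piece.outs]; omega)
        (by simp [Fits, Piece.ins, Piece.outs]; omega)
    have h2 : Isotopic m (m - 0 + 2) [⟨.cup, q⟩, ⟨.cross false, q + 1⟩, ⟨.cross true, q + 1⟩]
        [⟨.cup, q⟩] :=
      .step [⟨.cup, q⟩] [] (.reidemeister_two false (q + 1))
        (by simp [Fits, Piece.ins, Piece.outs]; omega)
        (by simp [Fits, Piece.ins, Piece.outs]; omega)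
    exact h2.symm.trans h1
  | cap =>
    simp only [Piece.ins, Piece.outs] at h ⊢
    have h1 : Isotopic m (m - 2 + 0) [⟨.cross true, q⟩, ⟨.cross false, q⟩, ⟨.cap, q + 1⟩]
        [⟨.cross true, q⟩, ⟨.cross true, q + 1⟩, ⟨.cap, q⟩] :=
      .step [⟨.cross true, q⟩] [] (.slide_cap false q)
        (by simp [Fits, Piece.ins, Piece.outs]; omega)
        (by simp [Fits, Piece.ins, Piece.outs]; omega)
    have h2 : Isotopic m (m - 2 + 0) [⟨.cross true, q⟩, ⟨.cross false, q⟩, ⟨.cap, q + 1⟩]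
        [⟨.cap, q + 1⟩] :=
      .step [] [⟨.cap, q + 1⟩] (.reidemeister_two true q)
        (by simp [Fits, Piece.ins, Piece.outs]; omega)
        (by simp [Fits, Piece.ins, Piece.outs]; omega)
    exact h1.symm.trans h2
  | cross b =>
    simp only [Piece.ins, Piece.outs] at h ⊢
    exact .move (.reidemeister_three true true b q fun _ => rfl)
      (fits_cross_cons (by omega) (fits_cross_cons (by omega)
        (fits_cross_cons (by omega) (by simp only [Fits]; omega))))
      (fits_cross_cons (by omega) (fits_cross_cons (by omega)
        (fits_cross_cons (by omega) (by simp only [Fits]; omega))))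

theorem pass_add_ins (s : Piece) (j : ℕ) : pass (j + s.ins) = passUnder s j ++ pass j := by
  cases s <;> rfl

theorem pass_add_outs (s : Piece) (j : ℕ) : pass (j + s.outs) = passUnder s.flip j ++ pass j := by
  rw [← pass_add_ins, Piece.flip_ins]

/-- A strand passes under a piece of the diagram from right to left. -/
theorem isotopic_pass_under (s : Piece) (j e m : ℕ) (h : j + s.ins + e + 1 ≤ m) :
    Isotopic m (m - s.ins + s.outs) (pass (j + s.ins + e) ++ [⟨s, j + 1⟩])
      (⟨s, j⟩ :: pass (j + s.outs + e)) := by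
  -- `e` counts the crossed strands to the right of the piece. They are crossed first, and those
  -- crossings are disjoint from the piece.
  induction e with
  | zero =>
    rw [add_zero, add_zero, pass_add_ins, pass_add_outs]
    have h0 : Fits (passUnder s j) m m := by
      have := fits_pass (k := j + s.ins) (m := m) (by omega)
      rw [pass_add_ins, fits_append] at this
      obtain ⟨k, h1, h2⟩ := this
      exact (h2.bottom_unique (fits_pass (by omega))) ▸ h1
    have h1 : Isotopic m (m - s.ins + s.outs) (passUnder s j ++ (pass j ++ [⟨s, j + 1⟩]))
        (passUnder s j ++ (⟨s, j + 1⟩ :: pass j)) :=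
      (Isotopic.refl h0).append (isotopic_append_slice s (j + 1) (pass j) (pass_spec le_rfl)
        (fits_cons (by omega) (fits_pass (by omega))))
    have h2 := (isotopic_passUnder s j m (by omega)).append
      (.refl (fits_pass (k := j) (m := m - s.ins + s.outs) (by omega)))
    simpa using h1.trans (by simpa using h2)
  | succ e ih =>
    have h1 : Fits [⟨.cross true, j + s.ins + e⟩] m m :=
      fits_cross_cons (by omega) rfl
    have h2 := (Isotopic.refl h1).append (ih (by omega))
    refine h2.trans ?_
    refine (Isotopic.step [] (pass (j + s.outs + e))
      (.far (i := j) (a := s) (b := .cross true) (j := j + s.outs + e) (j' := j + s.ins + e)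
        (by omega) (by omega)) ?_ ?_).symm
    · exact fits_cons (by omega) (fits_cross_cons (by omega) (fits_pass (by omega)))
    · exact h2.fits.2

/-- Two strands pass under `k` strands to their left. -/
def passPair (k : ℕ) : List Slice := pass k ++ shift 1 (pass k)

theorem shift_pass_succ (k : ℕ) :
    shift 1 (pass (k + 1)) = ⟨.cross true, k + 1⟩ :: shift 1 (pass k) := by
  simp [pass, add_comm]

theorem fits_passPair {k m : ℕ} (h : k + 2 ≤ m) : Fits (passPair k) m m := by
  refine (fits_pass (by omega)).append ?_
  have := (fits_pass (k := k) (m := m - 1) (by omega)).shift 1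
  rwa [show 1 + (m - 1) = m by omega] at this

theorem isotopic_passPair_succ {k m : ℕ} (h : k + 3 ≤ m) :
    Isotopic m m (passPair (k + 1))
      (⟨.cross true, k⟩ :: ⟨.cross true, k + 1⟩ :: passPair k) := by
  rw [passPair, shift_pass_succ, passPair]
  have h0 : Fits [⟨.cross true, k⟩] m m :=
    fits_single (by simp only [Piece.ins]; omega) (by simp only [Piece.ins, Piece.outs]; omega)
  have h1 : Fits (shift 1 (pass k)) m m := by
    have := (fits_pass (k := k) (m := m - 1) (by omega)).shift 1
    rwa [show 1 + (m - 1) = m by omega] at this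
  have h2 : Isotopic m m (pass k ++ [⟨.cross true, k + 1⟩]) (⟨.cross true, k + 1⟩ :: pass k) := by
    exact isotopic_append_slice _ (k + 1) (pass k) (pass_spec le_rfl)
      (fits_cross_cons (by omega) (fits_pass (by omega)))
  simpa [pass] using h2.context [⟨.cross true, k⟩] (shift 1 (pass k)) h0 h1

/-- The strands that enter a piece pass under `k` strands to their left. -/
def passStrands : ℕ → ℕ → List Slice
  | 2, k => passPair k
  | _, _ => []

theorem fits_passStrands {j k m : ℕ} (h : k + j ≤ m) : Fits (passStrands j k) m m := by
  unfold passStrands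
  split
  · exact fits_passPair h
  · rfl

/-- A piece passes under `k` strands from right to left. -/
theorem isotopic_passStrands (s : Piece) (k m : ℕ) (h : k + s.ins ≤ m) :
    Isotopic m (m - s.ins + s.outs) (passStrands s.ins k ++ [⟨s, 0⟩])
      (⟨s, k⟩ :: passStrands s.outs k) := by
  -- The over strand nearest to the piece is split off first. This gives the induction on the number
  -- of over strands.
  have key : ∀ (p : Piece) (k m : ℕ), k + 1 + p.ins ≤ m →
      Isotopic m m (passStrands p.ins (k + 1)) (passOver p k ++ passStrands p.ins k) := by
    intro p k m h
    cases p with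
    | cup => exact .refl rfl
    | cap => exact isotopic_passPair_succ h
    | cross b => exact isotopic_passPair_succ h
  induction k with
  | zero =>
    have : ∀ p : Piece, passStrands p.ins 0 = [] := by intro p; cases p <;> rfl
    rw [this, ← Piece.flip_ins, this]
    exact .refl (fits_single (by omega) (by simp))
  | succ k ih =>
    have hp := key s k m h
    have hq := key s.flip k (m - s.ins + s.outs) (by rw [Piece.flip_ins]; omega)
    rw [Piece.flip_ins] at hq
    obtain ⟨l, h1, h2⟩ := fits_append.1 hp.fits.2
    obtain rfl := (fits_passStrands (j := s.ins) (k := k) (m := m) (by omega)).bottom_unique h2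
    obtain ⟨l', h1', h2'⟩ := fits_append.1 hq.fits.2
    obtain rfl := h2'.bottom_unique (fits_passStrands (j := s.outs) (k := k) (by omega))
    have e1 := hp.append (.refl (fits_single (p := s) (i := 0) (m := m) (by omega) rfl))
    have e2 := (Isotopic.refl h1).append (ih (by omega))
    have e3 := (isotopic_passOver s k m (by omega)).append (.refl h2')
    have e4 := (Isotopic.refl (fits_single (p := s) (i := k + 1) (m := m) (by omega) rfl)).append hq
    refine e1.trans ?_
    simp only [List.append_assoc] at e2 ⊢
    refine e2.trans ?_
    simp only [List.append_assoc, List.cons_append, List.nil_append] at e3 e4 ⊢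
    exact e3.trans e4.symm

/-! ### Pieces slide through shuffles -/

theorem shuffle_replicate_true (j : ℕ) (c : List Bool) :
    shuffle (List.replicate j true ++ c) = shift j (shuffle c) := by
  induction j with
  | zero => simp
  | succ j ih => simp [List.replicate_succ, shuffle, ih, shift_shift, add_comm]

/-- The strands of `s` lie above everything labelled `false`. Hence each `false` strand that ends on
the left of `s` can be drawn under `s`, and those that end on the right never meet it. -/
theorem isotopic_shuffle_true (s : Piece) (l r : List Bool) :
    Isotopic (l.length + s.ins + r.length) (l.length + s.outs + r.length)
      (shuffle (l ++ (List.replicate s.ins true ++ r)) ++ [⟨s, l.length⟩])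
      (⟨s, l.count true⟩ :: shuffle (l ++ (List.replicate s.outs true ++ r))) := by
  induction l with
  | nil =>
    simp only [List.nil_append, shuffle_replicate_true, List.length_nil, List.count_nil, zero_add]
    have h := isotopic_cons_shift s 0 (shuffle r) (m := s.ins + r.length)
      (n := s.outs + r.length) ⟨by simp, ?_⟩
    · simpa using h.symm
    · simpa [add_comm] using (fits_shuffle r).shift s.outs
  | cons x l ih =>
    have ih' := ih.shift 1
    simp only [shift_append, shift_cons, shift_nil] at ih'
    have e1 : 1 + (l.length + s.ins + r.length) = (x :: l).length + s.ins + r.length := by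
      simp only [List.length_cons]; omega
    have e2 : 1 + (l.length + s.outs + r.length) = (x :: l).length + s.outs + r.length := by
      simp only [List.length_cons]; omega
    rw [e1, e2, add_comm 1, add_comm 1] at ih'
    cases x with
    | true => simpa [shuffle] using ih'
    | false =>
      have hl := l.count_le_length (a := true)
      have hr := r.count_le_length (a := true)
      have f1 : Fits (pass (l.count true + s.ins + r.count true))
          ((false :: l).length + s.ins + r.length) ((false :: l).length + s.ins + r.length) :=
        fits_pass (by simp only [List.length_cons]; omega)
      have h1 := (Isotopic.refl f1).append ih'
      have h2 := isotopic_pass_under s (l.count true) (r.count true)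
        ((false :: l).length + s.ins + r.length) (by simp only [List.length_cons]; omega)
      rw [show (false :: l).length + s.ins + r.length - s.ins + s.outs =
        (false :: l).length + s.outs + r.length by omega] at h2
      have f2 := (fits_shuffle (l ++ (List.replicate s.outs true ++ r))).shift 1
      rw [show 1 + (l ++ (List.replicate s.outs true ++ r)).length =
        (false :: l).length + s.outs + r.length by simp; omega] at f2
      have h3 := h2.append (.refl f2)
      simp only [List.append_assoc, List.cons_append, List.nil_append] at h1 h3
      simpa [shuffle, ← add_assoc] using h1.trans h3

theorem shuffle_replicate_false (s : Piece) (c : List Bool) :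
    shuffle (List.replicate s.ins false ++ c) =
      passStrands s.ins (c.count true) ++ shift s.ins (shuffle c) := by
  cases s <;> simp [Piece.ins, passStrands, passPair, shuffle, List.replicate, shift_shift]

/-- Below the braid all `true` strands are on the left, which gives the new position. On its way
down `s` slides under the `true` strands that end on its right, and the `false` strands that end on
its left stay clear of it. -/
theorem isotopic_shuffle_false (s : Piece) (l r : List Bool) :
    Isotopic (l.length + s.ins + r.length) (l.length + s.outs + r.length)
      (shuffle (l ++ (List.replicate s.ins false ++ r)) ++ [⟨s, l.length⟩])
      (⟨s, l.count true + r.count true + l.count false⟩ ::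
        shuffle (l ++ (List.replicate s.outs false ++ r))) := by
  have hr := r.count_le_length (a := true)
  induction l with
  | nil =>
    have hq := shuffle_replicate_false s.flip r
    rw [Piece.flip_ins] at hq
    simp only [List.nil_append, shuffle_replicate_false, hq, List.length_nil, List.count_nil,
      zero_add, add_zero]
    have h := isotopic_cons_shift s 0 (shuffle r) (m := s.ins + r.length)
      (n := s.outs + r.length) ⟨by simp, by simpa [add_comm] using (fits_shuffle r).shift s.outs⟩
    simp only [zero_add] at h
    have h1 := (Isotopic.refl (fits_passStrands (j := s.ins) (k := r.count true)
      (m := s.ins + r.length) (by omega))).append h.symm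
    have h2' := isotopic_passStrands s (r.count true) (s.ins + r.length) (by omega)
    rw [show s.ins + r.length - s.ins + s.outs = s.outs + r.length by omega] at h2'
    have h2 := h2'.append (.refl ((fits_shuffle r).shift s.outs))
    simp only [List.append_assoc, List.cons_append, List.nil_append] at h1 h2 ⊢
    exact h1.trans h2
  | cons x l ih =>
    have ih' := ih.shift 1
    simp only [shift_append, shift_cons, shift_nil] at ih'
    have e1 : 1 + (l.length + s.ins + r.length) = (x :: l).length + s.ins + r.length := by
      simp only [List.length_cons]; omega
    have e2 : 1 + (l.length + s.outs + r.length) = (x :: l).length + s.outs + r.length := by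
      simp only [List.length_cons]; omega
    rw [e1, e2, add_comm 1] at ih'
    cases x with
    | true =>
      simpa [shuffle, add_comm, add_left_comm, add_assoc] using ih'
    | false =>
      have hl := l.count_le_length (a := true)
      have hlf : l.count true + l.count false = l.length := by
        simp
      have f1 : Fits (pass (l.count true + r.count true))
          ((false :: l).length + s.ins + r.length) ((false :: l).length + s.ins + r.length) :=
        fits_pass (by simp only [List.length_cons]; omega)
      have h1 := (Isotopic.refl f1).append ih'
      have h2 := isotopic_append_slice s (1 + (l.count true + r.count true + l.count false))
        (pass (l.count true + r.count true)) (pass_spec (by omega))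
        (m := (false :: l).length + s.ins + r.length)
        (n := (false :: l).length + s.outs + r.length)
        ⟨by simp only [List.length_cons]; omega, by
          rw [show (false :: l).length + s.ins + r.length - s.ins + s.outs =
            (false :: l).length + s.outs + r.length by omega]
          exact fits_pass (by simp only [List.length_cons]; omega)⟩
      have f2 := (fits_shuffle (l ++ (List.replicate s.outs false ++ r))).shift 1
      rw [show 1 + (l ++ (List.replicate s.outs false ++ r)).length =
        (false :: l).length + s.outs + r.length by simp; omega] at f2
      have h3 := h2.append (.refl f2)
      simp only [List.append_assoc, List.cons_append, List.nil_append] at h1 h3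
      have h4 := h1.trans h3
      rw [show 1 + (l.count true + r.count true + l.count false) =
        l.count true + r.count true + (l.count false + 1) by omega] at h4
      simpa [shuffle, List.count_replicate] using h4

/-- A crossing in which `true` passes over `false` is absorbed by the braid. For `b = true` it is
the crossing by which the two braids differ. For `b = false` it cancels that crossing by the second
Reidemeister move. -/
theorem isotopic_shuffle_mixed (b : Bool) (l r : List Bool) :
    Isotopic (l.length + 2 + r.length) (l.length + 2 + r.length)
      (shuffle (l ++ (b :: (!b) :: r)) ++ [⟨.cross b, l.length⟩])
      (shuffle (l ++ ((!b) :: b :: r))) := by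
  have hr := r.count_le_length (a := true)
  induction l with
  | nil =>
    have hsr : Fits (shift 2 (shuffle r)) (2 + r.length) (2 + r.length) :=
      (fits_shuffle r).shift 2
    have hs : Fits (shift 1 (pass (r.count true))) (2 + r.length) (2 + r.length) := by
      have := (fits_pass (k := r.count true) (m := 1 + r.length) (by omega)).shift 1
      rwa [← add_assoc] at this
    have hx : ∀ c, Isotopic (2 + r.length) (2 + r.length)
        (shift 2 (shuffle r) ++ [⟨.cross c, 0⟩]) (⟨.cross c, 0⟩ :: shift 2 (shuffle r)) := by
      intro c
      have := isotopic_cons_shift (.cross c) 0 (shuffle r) (m := 2 + r.length)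
        (n := 2 + r.length) ⟨by simp [Piece.ins], by simpa [Piece.ins, Piece.outs, add_comm] using hsr⟩
      simpa [Piece.ins, Piece.outs] using this.symm
    have h0 : shuffle (false :: true :: r) =
        shift 1 (pass (r.count true)) ++ ([⟨.cross true, 0⟩] ++ shift 2 (shuffle r)) := by
      simp [shuffle, shift_shift, pass_succ]
    have h1 : shuffle (true :: false :: r) =
        shift 1 (pass (r.count true)) ++ shift 2 (shuffle r) := by
      simp [shuffle, shift_shift]
    cases b with
    | true =>
      rw [List.nil_append, List.nil_append, Bool.not_true, h0, h1, List.length_nil, zero_add]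
      simpa using (Isotopic.refl hs).append (hx true)
    | false =>
      rw [List.nil_append, List.nil_append, Bool.not_false, h0, h1, List.length_nil, zero_add]
      have f1 : Fits [⟨.cross true, 0⟩] (2 + r.length) (2 + r.length) :=
        fits_single (by simp [Piece.ins]) (by simp only [Piece.ins, Piece.outs]; omega)
      have f2 := (Isotopic.refl (hs.append f1)).append (hx false)
      have f3 : Isotopic (2 + r.length) (2 + r.length) [⟨.cross true, 0⟩, ⟨.cross false, 0⟩] [] :=
        .move (.reidemeister_two true 0) (by simp [Fits, Piece.ins, Piece.outs]; omega) rfl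
      have f4 := f3.context _ _ hs hsr
      simp only [List.append_assoc, List.cons_append, List.nil_append] at f2 f4 ⊢
      exact f2.trans f4
  | cons x l ih =>
    have ih' := ih.shift 1
    simp only [shift_append, shift_cons, shift_nil] at ih'
    rw [show 1 + (l.length + 2 + r.length) = (x :: l).length + 2 + r.length by
      simp only [List.length_cons]; omega, add_comm 1] at ih'
    cases x with
    | true => simpa [shuffle] using ih'
    | false =>
      have hl := l.count_le_length (a := true)
      have f1 : Fits (pass (l.count true + (r.count true + 1)))
          ((false :: l).length + 2 + r.length) ((false :: l).length + 2 + r.length) :=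
        fits_pass (by simp only [List.length_cons]; omega)
      have h1 := (Isotopic.refl f1).append ih'
      cases b <;> simpa [shuffle] using h1

/-! ### Coloured words -/

/-- A piece with the colours of its strands; `cross b a o` has over strand `a` and under strand `o`
below the crossing. -/
inductive Core : Type
  | cup (x : ℤ)
  | cap (x : ℤ)
  | cross (b : Bool) (a o : ℤ)

/-- The piece without its colours. -/
def Core.piece : Core → Piece
  | .cup _ => .cup
  | .cap _ => .cap
  | .cross b _ _ => .cross b

/-- The colours of the strands that enter the piece from below. -/
def Core.bot : Core → List ℤ
  | .cup _ => []
  | .cap x => [x, x]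
  | .cross true a o => [a, o]
  | .cross false a o => [o, a]

/-- The colours of the strands that leave the piece at the top. -/
def Core.top : Core → List ℤ
  | .cup x => [x, x]
  | .cap _ => []
  | .cross true a o => [2 * a - o, a]
  | .cross false a o => [a, 2 * a - o]

@[simp] theorem Core.length_bot (k : Core) : k.bot.length = k.piece.ins := by
  rcases k with _ | _ | ⟨_ | _, _, _⟩ <;> rfl

@[simp] theorem Core.length_top (k : Core) : k.top.length = k.piece.outs := by
  rcases k with _ | _ | ⟨_ | _, _, _⟩ <;> rfl

/-- A slice with the colours of its strands: those to the left of the piece, those of the piece,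
and those to its right. -/
structure CSlice : Type where
  l : List ℤ
  core : Core
  r : List ℤ

/-- The colours below a slice. -/
def CSlice.bot (s : CSlice) : List ℤ := s.l ++ (s.core.bot ++ s.r)

/-- The colours above a slice. -/
def CSlice.top (s : CSlice) : List ℤ := s.l ++ (s.core.top ++ s.r)

/-- The slice without its colours. -/
def CSlice.slice (s : CSlice) : Slice := ⟨s.core.piece, s.l.length⟩

/-- The colours of the slices fit together, from `c` below to `c'` above. -/
def Chain : List CSlice → List ℤ → List ℤ → Prop
  | [], c, c' => c = c'
  | s :: W, c, c' => c = s.bot ∧ Chain W s.top c'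

/-- The word without its colours. -/
def word (W : List CSlice) : List Slice := W.map CSlice.slice

@[simp] theorem word_nil : word [] = [] := rfl

@[simp] theorem word_cons (s : CSlice) (W : List CSlice) : word (s :: W) = s.slice :: word W := rfl

@[simp] theorem word_append (U V : List CSlice) : word (U ++ V) = word U ++ word V :=
  List.map_append

theorem chain_append {U V : List CSlice} {c c' : List ℤ} :
    Chain (U ++ V) c c' ↔ ∃ d, Chain U c d ∧ Chain V d c' := by
  induction U generalizing c with
  | nil => simp [Chain]
  | cons s U ih => simp [Chain, ih, and_assoc]

theorem Chain.append {U V : List CSlice} {c d c' : List ℤ} (hU : Chain U c d)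
    (hV : Chain V d c') : Chain (U ++ V) c c' :=
  chain_append.2 ⟨d, hU, hV⟩

theorem Chain.fits {W : List CSlice} {c c' : List ℤ} (h : Chain W c c') :
    Fits (word W) c.length c'.length := by
  induction W generalizing c with
  | nil => exact congrArg List.length h
  | cons s W ih =>
    obtain ⟨rfl, h⟩ := h
    refine fits_cons ?_ ?_
    · simp only [CSlice.bot, List.length_append, Core.length_bot]
      omega
    · have := ih h
      simp only [CSlice.bot, CSlice.top, List.length_append, Core.length_bot,
        Core.length_top] at this ⊢
      rwa [show s.l.length + (s.core.piece.ins + s.r.length) - s.core.piece.ins +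
        s.core.piece.outs = s.l.length + (s.core.piece.outs + s.r.length) by omega]

/-- Every colour above a word without strands below it occurs at the top of one of its pieces. -/
theorem Chain.exists_mem_top {W : List CSlice} {c : List ℤ} (h : Chain W [] c) {x : ℤ}
    (hx : x ∈ c) : ∃ s ∈ W, x ∈ s.core.top := by
  induction W using List.reverseRecOn generalizing c with
  | nil =>
    obtain rfl : [] = c := h
    simp at hx
  | append_singleton W s ih =>
    obtain ⟨d, hW, rfl, h⟩ := chain_append.1 h
    obtain rfl : s.top = c := h
    simp only [CSlice.top, List.mem_append] at hx
    have key : x ∈ s.bot → ∃ t ∈ W ++ [s], x ∈ t.core.top := fun hx => by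
      obtain ⟨t, ht, h⟩ := ih hW hx
      exact ⟨t, by simp [ht], h⟩
    obtain hx | hx | hx := hx
    · exact key (by simp [CSlice.bot, hx])
    · exact ⟨s, by simp, hx⟩
    · exact key (by simp [CSlice.bot, hx])

/-! ### Split links -/

/-- In the mixed case the sign `b` of the crossing is also the label of its bottom left strand,
because that strand is the over strand exactly for `cross true`. -/
theorem Core.label_cases (χ : ℤ → Bool) (k : Core)
    (h : ∀ b a o, k = .cross b a o → χ (2 * a - o) = χ o ∧ (χ a ≠ χ o → χ a = true)) :
    (k.bot.map χ = List.replicate k.piece.ins true ∧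
        k.top.map χ = List.replicate k.piece.outs true) ∨
      (k.bot.map χ = List.replicate k.piece.ins false ∧
        k.top.map χ = List.replicate k.piece.outs false) ∨
      ∃ b, k.piece = .cross b ∧ k.bot.map χ = [b, !b] ∧ k.top.map χ = [!b, b] := by
  rcases k with x | x | ⟨b, a, o⟩
  · cases hx : χ x <;> simp [Core.bot, Core.top, Core.piece, Piece.ins, Piece.outs, hx]
  · cases hx : χ x <;> simp [Core.bot, Core.top, Core.piece, Piece.ins, Piece.outs, hx]
  · obtain ⟨h1, h2⟩ := h b a o rfl
    cases b <;> cases ha : χ a <;> cases ho : χ o <;>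
      simp_all [Core.bot, Core.top, Core.piece, Piece.ins, Piece.outs]

/-- The piece descends through the braid and then past `v`, which lies entirely to its right, and
joins the end of `u`. -/
theorem isotopic_split_append_true (p : Piece) (L R : List Bool) {u v : List Slice}
    (hu : Fits u 0 (L.count true + p.ins + R.count true))
    (hv : Fits v 0 (L.count false + R.count false)) :
    Isotopic 0 (L.length + p.outs + R.length)
      (u ++ (shift (L.count true + p.ins + R.count true) v ++
        shuffle (L ++ (List.replicate p.ins true ++ R))) ++ [⟨p, L.length⟩])
      (u ++ [⟨p, L.count true⟩] ++ (shift (L.count true + p.outs + R.count true) v ++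
        shuffle (L ++ (List.replicate p.outs true ++ R)))) := by
  have hL : L.count true + L.count false = L.length := by simp
  have hR : R.count true + R.count false = R.length := by simp
  have f1 := hv.shift (L.count true + p.ins + R.count true)
  have f2 := hv.shift (L.count true + p.outs + R.count true)
  have f3 := fits_shuffle (L ++ (List.replicate p.outs true ++ R))
  simp only [List.length_append, List.length_replicate, ← add_assoc] at f3
  rw [add_zero, show L.count true + p.ins + R.count true + (L.count false + R.count false) =
    L.length + p.ins + R.length by omega] at f1
  have h1 := (Isotopic.refl (hu.append f1)).append (isotopic_shuffle_true p L R)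
  have h2 := isotopic_cons_shift p (L.count true) (shift (R.count true) v)
    (m := L.count true + p.ins + R.count true) (n := L.length + p.outs + R.length)
    (fits_cons (by omega) (by
      rw [shift_shift]
      convert f2 using 1 <;> omega))
  have h3 := h2.symm.context _ _ hu f3
  simp only [shift_shift, List.append_assoc, List.cons_append, List.nil_append] at h1 h3 ⊢
  exact h1.trans h3

theorem isotopic_split_append_false (p : Piece) (L R : List Bool) {u v : List Slice}
    (hu : Fits u 0 (L.count true + R.count true))
    (hv : Fits v 0 (L.count false + p.ins + R.count false)) :
    Isotopic 0 (L.length + p.outs + R.length)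
      (u ++ (shift (L.count true + R.count true) v ++
        shuffle (L ++ (List.replicate p.ins false ++ R))) ++ [⟨p, L.length⟩])
      (u ++ (shift (L.count true + R.count true) (v ++ [⟨p, L.count false⟩]) ++
        shuffle (L ++ (List.replicate p.outs false ++ R)))) := by
  have hL : L.count true + L.count false = L.length := by simp
  have hR : R.count true + R.count false = R.length := by simp
  have f1 := hv.shift (L.count true + R.count true)
  rw [add_zero, show L.count true + R.count true + (L.count false + p.ins + R.count false) =
    L.length + p.ins + R.length by omega] at f1
  have h1 := (Isotopic.refl (hu.append f1)).append (isotopic_shuffle_false p L R)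
  simpa using h1

theorem isotopic_split_append_mixed (b : Bool) (L R : List Bool) {u v : List Slice}
    (hu : Fits u 0 (L.count true + 1 + R.count true))
    (hv : Fits v 0 (L.count false + 1 + R.count false)) :
    Isotopic 0 (L.length + 2 + R.length)
      (u ++ (shift (L.count true + 1 + R.count true) v ++
        shuffle (L ++ (b :: (!b) :: R))) ++ [⟨.cross b, L.length⟩])
      (u ++ (shift (L.count true + 1 + R.count true) v ++
        shuffle (L ++ ((!b) :: b :: R)))) := by
  have hL : L.count true + L.count false = L.length := by simp
  have hR : R.count true + R.count false = R.length := by simp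
  have f1 := hv.shift (L.count true + 1 + R.count true)
  rw [add_zero, show L.count true + 1 + R.count true + (L.count false + 1 + R.count false) =
    L.length + 2 + R.length by omega] at f1
  have h1 := (Isotopic.refl (hu.append f1)).append (isotopic_shuffle_mixed b L R)
  simpa using h1

theorem Fits.ne_nil {w : List Slice} {n : ℕ} (h : Fits w 0 n) (hn : 0 < n) : w ≠ [] := by
  rintro rfl
  exact hn.ne h

/-- If the strands of the colours with the label `true` pass over all other strands, then they can
be moved below the others. -/
theorem Chain.exists_split (χ : ℤ → Bool) {W : List CSlice} {c : List ℤ} (h : Chain W [] c)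
    (hχ : ∀ s ∈ W, ∀ b a o, s.core = .cross b a o →
      χ (2 * a - o) = χ o ∧ (χ a ≠ χ o → χ a = true)) :
    ∃ u v : List Slice, Fits u 0 ((c.map χ).count true) ∧ Fits v 0 ((c.map χ).count false) ∧
      Isotopic 0 c.length (word W)
        (u ++ (shift ((c.map χ).count true) v ++ shuffle (c.map χ))) ∧
      ∀ s ∈ W, ∀ x ∈ s.core.bot ++ s.core.top,
        (χ x = true → u ≠ []) ∧ (χ x = false → v ≠ []) := by
  -- The diagram is read from below. The `true` part `u` and the `false` part `v` to its right are
  -- kept disjoint, and a braid on top of them restores the order of the strands. Each new slice is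
  -- added to `u` or `v` or is absorbed by the braid.
  induction W using List.reverseRecOn generalizing c with
  | nil =>
    obtain rfl : [] = c := h
    exact ⟨[], [], rfl, rfl, .refl rfl, by simp⟩
  | append_singleton W s ih =>
    obtain ⟨d, hW, rfl, h⟩ := chain_append.1 h
    obtain rfl : s.top = c := h
    obtain ⟨u, v, hu, hv, hiso, hmem⟩ := ih hW fun t ht => hχ t (by simp [ht])
    have hs := hχ s (by simp)
    obtain ⟨l, k, r⟩ := s
    have hlabel : ∀ (u' v' : List Slice), (u ≠ [] → u' ≠ []) → (v ≠ [] → v' ≠ []) →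
        (∀ e ∈ (k.bot ++ k.top).map χ, (e = true → u' ≠ []) ∧ (e = false → v' ≠ [])) →
        ∀ s ∈ W ++ [⟨l, k, r⟩], ∀ x ∈ s.core.bot ++ s.core.top,
          (χ x = true → u' ≠ []) ∧ (χ x = false → v' ≠ []) := by
      intro u' v' h1 h2 h3 s hs x hx
      obtain hs | hs := List.mem_append.1 hs
      · exact ⟨fun h => h1 ((hmem s hs x hx).1 h), fun h => h2 ((hmem s hs x hx).2 h)⟩
      · obtain rfl := List.mem_singleton.1 hs
        exact h3 _ (List.mem_map_of_mem hx)
    have hslice : word [⟨l, k, r⟩] = [⟨k.piece, (l.map χ).length⟩] := by simp [CSlice.slice]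
    have hfs : Isotopic (CSlice.bot ⟨l, k, r⟩).length (CSlice.top ⟨l, k, r⟩).length
        (word [⟨l, k, r⟩]) (word [⟨l, k, r⟩]) :=
      .refl (Chain.fits (W := [⟨l, k, r⟩]) ⟨rfl, rfl⟩)
    have h1 := hiso.append hfs
    have htop : (CSlice.top ⟨l, k, r⟩).length =
        (l.map χ).length + k.piece.outs + (r.map χ).length := by
      simp [CSlice.top, add_assoc]
    rw [word_append]
    rw [htop] at h1 ⊢
    rw [hslice] at h1 ⊢
    simp only [CSlice.bot, CSlice.top, List.map_append, List.count_append] at hu hv h1 ⊢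
    simp only [List.map_append] at hlabel
    generalize l.map χ = L at *
    generalize r.map χ = R at *
    obtain ⟨hb, ht⟩ | ⟨hb, ht⟩ | ⟨b, hp, hb, ht⟩ := k.label_cases χ hs
    · rw [hb] at hu hv h1 hlabel
      rw [ht] at hlabel ⊢
      generalize k.piece = p at *
      simp only [List.count_replicate, beq_self_eq_true, if_true, ← add_assoc,
        show (true == false) = false from rfl, Bool.false_eq_true, if_false, add_zero]
        at hu hv h1 ⊢
      have hp : Fits [⟨p, L.count true⟩] (L.count true + p.ins + R.count true)
          (L.count true + p.outs + R.count true) := fits_single (by omega) (by omega)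
      refine ⟨u ++ [⟨p, L.count true⟩], v, hu.append hp, hv,
        h1.trans (isotopic_split_append_true p L R hu hv), hlabel _ _ ?_ ?_ ?_⟩
      · simp
      · exact id
      · simp +contextual
    · rw [hb] at hu hv h1 hlabel
      rw [ht] at hlabel ⊢
      generalize k.piece = p at *
      simp only [List.count_replicate, beq_self_eq_true, if_true, ← add_assoc,
        show (false == true) = false from rfl, Bool.false_eq_true, if_false, add_zero]
        at hu hv h1 ⊢
      have hp : Fits [⟨p, L.count false⟩] (L.count false + p.ins + R.count false)
          (L.count false + p.outs + R.count false) := fits_single (by omega) (by omega)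
      refine ⟨u, v ++ [⟨p, L.count false⟩], hu, hv.append hp,
        h1.trans (isotopic_split_append_false p L R hu hv), hlabel _ _ ?_ ?_ ?_⟩
      · exact id
      · simp
      · simp +contextual
    · rw [hb] at hu hv h1
      rw [ht]
      rw [hp] at h1 ⊢
      have hc : ∀ e b : Bool, List.count e [b, !b] = 1 ∧ List.count e [!b, b] = 1 := by decide
      simp only [hc, ← add_assoc, List.cons_append, List.nil_append] at hu hv h1 ⊢
      -- No piece is added here. Both parts are non-empty because each already has a strand entering
      -- this crossing.
      refine ⟨u, v, hu, hv, h1.trans (isotopic_split_append_mixed b L R hu hv),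
        hlabel _ _ id id fun e _ => ⟨fun _ => hu.ne_nil ?_, fun _ => hv.ne_nil ?_⟩⟩
      · omega
      · omega

/-- A link is splittable if it has a diagram with two kinds of strands, both of which occur, such
that those of the first kind pass over those of the second kind. -/
theorem Chain.isSplittable (χ : ℤ → Bool) {D : Diagram} {W : List CSlice} (h : Chain W [] [])
    (hD : D.slices = word W)
    (hχ : ∀ s ∈ W, ∀ b a o, s.core = .cross b a o →
      χ (2 * a - o) = χ o ∧ (χ a ≠ χ o → χ a = true))
    (htrue : ∃ s ∈ W, ∃ x ∈ s.core.bot ++ s.core.top, χ x = true)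
    (hfalse : ∃ s ∈ W, ∃ x ∈ s.core.bot ++ s.core.top, χ x = false) :
    D.link.IsSplittable := by
  obtain ⟨u, v, hu, hv, hiso, hmem⟩ := h.exists_split χ hχ
  obtain ⟨s, hs, x, hx, hxt⟩ := htrue
  obtain ⟨t, ht, y, hy, hyf⟩ := hfalse
  -- No strands are left at the top, so the braid is empty and `v` is shifted by `0`. The two parts
  -- are closed diagrams.
  simp only [List.map_nil, List.count_nil, shift_zero, shuffle, List.append_nil] at hu hv hiso
  refine ⟨⟨u ++ v, hu.append hv⟩, ⟨u, hu⟩, ⟨v, hv⟩, ?_, (hmem s hs x hx).1 hxt,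
    (hmem t ht y hy).2 hyf, rfl⟩
  refine (Isotopic.link_eq ?_).symm
  rw [hD]
  exact hiso

/-! ### Isotopies of the tip of a finger that passes over a strand -/

/-- A crossing of the strands in the positions `i` and `i + 1`. -/
abbrev crossAt (b : Bool) (i : ℕ) : Slice := ⟨.cross b, i⟩

/-- A maximum of the strands in the positions `i` and `i + 1`. -/
abbrev capAt (i : ℕ) : Slice := ⟨.cap, i⟩

/-- A minimum whose strands are in the positions `i` and `i + 1`. -/
abbrev cupAt (i : ℕ) : Slice := ⟨.cup, i⟩

/-- The tip of a finger slides over a maximum to its right. -/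
theorem isotopic_tip_cap_right {p m : ℕ} (h : p + 4 ≤ m) :
    Isotopic m (m - 4) [crossAt true p, capAt (p + 1), capAt p]
      [crossAt true (p + 2), capAt (p + 1), capAt p] := by
  have h1 : Isotopic m (m - 4) [crossAt true p, capAt (p + 1), capAt p]
      [crossAt false (p + 1), capAt p, capAt p] :=
    .step [] [capAt p] (.slide_cap true p)
      (by simp only [Fits, Piece.ins, Piece.outs, List.cons_append, List.nil_append]; omega)
      (by simp only [Fits, Piece.ins, Piece.outs, List.cons_append, List.nil_append]; omega)
  have h2 : Isotopic m (m - 4) [crossAt false (p + 1), capAt p, capAt p]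
      [crossAt false (p + 1), capAt (p + 2), capAt p] :=
    .step [crossAt false (p + 1)] [] (.far (by simp [Piece.ins]) (by simp [Piece.ins, Piece.outs]))
      (by simp only [Fits, Piece.ins, Piece.outs, List.cons_append, List.nil_append]; omega)
      (by simp only [Fits, Piece.ins, Piece.outs, List.cons_append, List.nil_append]; omega)
  have h3 : Isotopic m (m - 4) [crossAt true (p + 2), capAt (p + 1), capAt p]
      [crossAt false (p + 1), capAt (p + 2), capAt p] :=
    (Isotopic.step [] [capAt p] (.slide_cap false (p + 1))
      (by simp only [Fits, Piece.ins, Piece.outs, List.cons_append, List.nil_append]; omega)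
      (by simp only [Fits, Piece.ins, Piece.outs, List.cons_append, List.nil_append, Bool.not_false];
          omega)).symm
  exact (h1.trans h2).trans h3.symm

/-- The tip of a finger slides over a maximum to its left. -/
theorem isotopic_tip_cap_left {q m : ℕ} (h : q + 4 ≤ m) :
    Isotopic m (m - 4) [crossAt true (q + 1), capAt (q + 2), capAt q]
      [crossAt false q, capAt (q + 1), capAt q] := by
  have h1 : Isotopic m (m - 4) [crossAt true (q + 1), capAt q, capAt q]
      [crossAt true (q + 1), capAt (q + 2), capAt q] :=
    .step [crossAt true (q + 1)] [] (.far (by simp [Piece.ins]) (by simp [Piece.ins, Piece.outs]))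
      (by simp only [Fits, Piece.ins, Piece.outs, List.cons_append, List.nil_append]; omega)
      (by simp only [Fits, Piece.ins, Piece.outs, List.cons_append, List.nil_append]; omega)
  have h2 : Isotopic m (m - 4) [crossAt false q, capAt (q + 1), capAt q]
      [crossAt true (q + 1), capAt q, capAt q] :=
    .step [] [capAt q] (.slide_cap false q)
      (by simp only [Fits, Piece.ins, Piece.outs, List.cons_append, List.nil_append]; omega)
      (by simp only [Fits, Piece.ins, Piece.outs, List.cons_append, List.nil_append, Bool.not_false];
          omega)
  exact (h2.trans h1).symm

/-- The tip of a finger passes a crossing with the strand to its right. -/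
theorem isotopic_tip_cross_right (b : Bool) {p m : ℕ} (h : p + 4 ≤ m) :
    Isotopic m (m - 2) [crossAt true p, capAt (p + 1), crossAt b p]
      [crossAt true (p + 2), crossAt b (p + 1), crossAt true p, crossAt true (p + 1),
        capAt (p + 2)] := by
  have h1 : Isotopic m (m - 2) [crossAt true p, capAt (p + 1), crossAt b p]
      [crossAt false (p + 1), capAt p, crossAt b p] :=
    .step [] [crossAt b p] (.slide_cap true p)
      (by simp only [Fits, Piece.ins, Piece.outs, List.cons_append, List.nil_append]; omega)
      (by simp only [Fits, Piece.ins, Piece.outs, List.cons_append, List.nil_append]; omega)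
  have h2 : Isotopic m (m - 2) [crossAt false (p + 1), capAt p, crossAt b p]
      [crossAt false (p + 1), crossAt b (p + 2), capAt p] :=
    .step [crossAt false (p + 1)] [] (.far (by simp [Piece.ins]) (by simp [Piece.ins, Piece.outs]))
      (by simp only [Fits, Piece.ins, Piece.outs, List.cons_append, List.nil_append]; omega)
      (by simp only [Fits, Piece.ins, Piece.outs, List.cons_append, List.nil_append]; omega)
  -- A cancelling pair of crossings is inserted, so that the tip can reappear beyond the crossing
  -- `b`.
  have h3 : Isotopic m (m - 2)
      [crossAt false (p + 1), crossAt b (p + 2), crossAt true (p + 1), crossAt false (p + 1), capAt p]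
      [crossAt false (p + 1), crossAt b (p + 2), capAt p] :=
    .step [crossAt false (p + 1), crossAt b (p + 2)] [capAt p] (.reidemeister_two true (p + 1))
      (by simp only [Fits, Piece.ins, Piece.outs, List.cons_append, List.nil_append, Bool.not_true];
          omega)
      (by simp only [Fits, Piece.ins, Piece.outs, List.cons_append, List.nil_append]; omega)
  have h4 : Isotopic m (m - 2)
      [crossAt false (p + 1), crossAt b (p + 2), crossAt true (p + 1), crossAt true p, capAt (p + 1)]
      [crossAt false (p + 1), crossAt b (p + 2), crossAt true (p + 1), crossAt false (p + 1),
        capAt p] :=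
    .step [crossAt false (p + 1), crossAt b (p + 2), crossAt true (p + 1)] [] (.slide_cap true p)
      (by simp only [Fits, Piece.ins, Piece.outs, List.cons_append, List.nil_append]; omega)
      (by simp only [Fits, Piece.ins, Piece.outs, List.cons_append, List.nil_append]; omega)
  -- Of the three strands the middle one, which belongs to the finger, is over both others. The
  -- level condition therefore holds for either `b`.
  have h5 : Isotopic m (m - 2)
      [crossAt false (p + 1), crossAt b (p + 2), crossAt true (p + 1), crossAt true p, capAt (p + 1)]
      [crossAt true (p + 2), crossAt b (p + 1), crossAt false (p + 2), crossAt true p,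
        capAt (p + 1)] :=
    .step [] [crossAt true p, capAt (p + 1)]
      (.reidemeister_three false b true (p + 1) (fun h => by simp at h))
      (by simp only [Fits, Piece.ins, Piece.outs, List.cons_append, List.nil_append]; omega)
      (by simp only [Fits, Piece.ins, Piece.outs, List.cons_append, List.nil_append]; omega)
  have h6 : Isotopic m (m - 2)
      [crossAt true (p + 2), crossAt b (p + 1), crossAt true p, crossAt false (p + 2),
        capAt (p + 1)]
      [crossAt true (p + 2), crossAt b (p + 1), crossAt false (p + 2), crossAt true p,
        capAt (p + 1)] :=
    .step [crossAt true (p + 2), crossAt b (p + 1)] [capAt (p + 1)]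
      (.far (by simp [Piece.ins]) (by simp [Piece.ins, Piece.outs]))
      (by simp only [Fits, Piece.ins, Piece.outs, List.cons_append, List.nil_append]; omega)
      (by simp only [Fits, Piece.ins, Piece.outs, List.cons_append, List.nil_append]; omega)
  have h7 : Isotopic m (m - 2)
      [crossAt true (p + 2), crossAt b (p + 1), crossAt true p, crossAt true (p + 1),
        capAt (p + 2)]
      [crossAt true (p + 2), crossAt b (p + 1), crossAt true p, crossAt false (p + 2),
        capAt (p + 1)] :=
    .step [crossAt true (p + 2), crossAt b (p + 1), crossAt true p] [] (.slide_cap true (p + 1))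
      (by simp only [Fits, Piece.ins, Piece.outs, List.cons_append, List.nil_append]; omega)
      (by simp only [Fits, Piece.ins, Piece.outs, List.cons_append, List.nil_append]; omega)
  exact (h1.trans h2).trans (h3.symm.trans (h4.symm.trans (h5.trans (h6.symm.trans h7.symm))))

/-- The tip of a finger passes a crossing with the strand to its left. -/
theorem isotopic_tip_cross_left (b : Bool) {q m : ℕ} (h : q + 4 ≤ m) :
    Isotopic m (m - 2) [crossAt true (q + 1), capAt (q + 2), crossAt b q]
      [crossAt false q, crossAt b (q + 1), crossAt false (q + 2), crossAt true q,
        capAt (q + 1)] := by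
  have h1 : Isotopic m (m - 2) [crossAt true (q + 1), crossAt b q, capAt (q + 2)]
      [crossAt true (q + 1), capAt (q + 2), crossAt b q] :=
    .step [crossAt true (q + 1)] [] (.far (by simp [Piece.ins]) (by simp [Piece.ins, Piece.outs]))
      (by simp only [Fits, Piece.ins, Piece.outs, List.cons_append, List.nil_append]; omega)
      (by simp only [Fits, Piece.ins, Piece.outs, List.cons_append, List.nil_append]; omega)
  have h2 : Isotopic m (m - 2)
      [crossAt true (q + 1), crossAt b q, crossAt false (q + 1), crossAt true (q + 1),
        capAt (q + 2)]
      [crossAt true (q + 1), crossAt b q, capAt (q + 2)] :=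
    .step [crossAt true (q + 1), crossAt b q] [capAt (q + 2)] (.reidemeister_two false (q + 1))
      (by simp only [Fits, Piece.ins, Piece.outs, List.cons_append, List.nil_append, Bool.not_false];
          omega)
      (by simp only [Fits, Piece.ins, Piece.outs, List.cons_append, List.nil_append]; omega)
  have h3 : Isotopic m (m - 2)
      [crossAt true (q + 1), crossAt b q, crossAt false (q + 1), crossAt true (q + 1),
        capAt (q + 2)]
      [crossAt true (q + 1), crossAt b q, crossAt false (q + 1), crossAt false (q + 2),
        capAt (q + 1)] :=
    .step [crossAt true (q + 1), crossAt b q, crossAt false (q + 1)] [] (.slide_cap true (q + 1))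
      (by simp only [Fits, Piece.ins, Piece.outs, List.cons_append, List.nil_append]; omega)
      (by simp only [Fits, Piece.ins, Piece.outs, List.cons_append, List.nil_append]; omega)
  have h4 : Isotopic m (m - 2)
      [crossAt false q, crossAt b (q + 1), crossAt true q, crossAt false (q + 2), capAt (q + 1)]
      [crossAt true (q + 1), crossAt b q, crossAt false (q + 1), crossAt false (q + 2),
        capAt (q + 1)] :=
    .step [] [crossAt false (q + 2), capAt (q + 1)]
      (.reidemeister_three false b true q (fun h => by simp at h))
      (by simp only [Fits, Piece.ins, Piece.outs, List.cons_append, List.nil_append]; omega)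
      (by simp only [Fits, Piece.ins, Piece.outs, List.cons_append, List.nil_append]; omega)
  have h5 : Isotopic m (m - 2)
      [crossAt false q, crossAt b (q + 1), crossAt true q, crossAt false (q + 2), capAt (q + 1)]
      [crossAt false q, crossAt b (q + 1), crossAt false (q + 2), crossAt true q,
        capAt (q + 1)] :=
    .step [crossAt false q, crossAt b (q + 1)] [capAt (q + 1)]
      (.far (by simp [Piece.ins]) (by simp [Piece.ins, Piece.outs]))
      (by simp only [Fits, Piece.ins, Piece.outs, List.cons_append, List.nil_append]; omega)
      (by simp only [Fits, Piece.ins, Piece.outs, List.cons_append, List.nil_append]; omega)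
  exact (h1.symm.trans h2.symm).trans (h3.trans (h4.symm.trans h5))

/-- A strand is deformed into a curl. -/
theorem isotopic_curl {i m : ℕ} (h : i + 1 ≤ m) :
    Isotopic m m [] [cupAt (i + 1), crossAt true i, capAt (i + 1)] := by
  have h1 : Isotopic m m [cupAt (i + 1), crossAt true i, capAt (i + 1)]
      [cupAt (i + 1), crossAt false (i + 1), capAt i] :=
    .step [cupAt (i + 1)] [] (.slide_cap true i)
      (by simp only [Fits, Piece.ins, Piece.outs, List.cons_append, List.nil_append]; omega)
      (by simp only [Fits, Piece.ins, Piece.outs, List.cons_append, List.nil_append]; omega)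
  have h2 : Isotopic m m [cupAt (i + 1), crossAt false (i + 1), capAt i]
      [cupAt (i + 1), capAt i] :=
    .step [] [capAt i] (.reidemeister_one_cup false (i + 1))
      (by simp only [Fits, Piece.ins, Piece.outs, List.cons_append, List.nil_append]; omega)
      (by simp only [Fits, Piece.ins, Piece.outs, List.cons_append, List.nil_append]; omega)
  have h3 : Isotopic m m [cupAt (i + 1), capAt i] [] :=
    .step [] [] (.zigzag_right i)
      (by simp only [Fits, Piece.ins, Piece.outs, List.cons_append, List.nil_append]; omega)
      (by simp only [Fits, List.nil_append])
  exact (h1.trans (h2.trans h3)).symm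

/-- The strand between the tip of a finger and a crossing under the strand to its right passes over
both of them in a curl. -/
theorem isotopic_tip_curl_right {p m : ℕ} (h : p + 4 ≤ m) :
    Isotopic m (m - 2) [crossAt true p, capAt (p + 1), crossAt false p]
      [cupAt (p + 2), crossAt false p, crossAt true (p + 1), crossAt false (p + 2), capAt (p + 3),
        crossAt true (p + 2), crossAt false (p + 1), crossAt true p, crossAt true (p + 1),
        capAt (p + 2)] := by
  have h1 : Isotopic m (m - 2) [crossAt true p, capAt (p + 1), crossAt false p]
      [cupAt (p + 2), crossAt true (p + 1), capAt (p + 2), crossAt true p, capAt (p + 1),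
        crossAt false p] :=
    (isotopic_curl (i := p + 1) (m := m) (by omega)).context' [] _ rfl
      (by simp only [Fits, Piece.ins, Piece.outs, List.nil_append]; omega)
  -- The crossing and the maximum of the curl have the shape of the tip of a finger over its own
  -- strand. This tip passes over the crossing at the tip of the given finger, and in `h5` over the
  -- second crossing.
  have h2 : Isotopic m (m - 2)
      [cupAt (p + 2), crossAt true (p + 1), capAt (p + 2), crossAt true p, capAt (p + 1),
        crossAt false p]
      [cupAt (p + 2), crossAt false p, crossAt true (p + 1), crossAt false (p + 2), crossAt true p,
        capAt (p + 1), capAt (p + 1), crossAt false p] :=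
    (isotopic_tip_cross_left true (q := p) (m := m + 2) (by omega)).context' [cupAt (p + 2)]
      [capAt (p + 1), crossAt false p] (fits_single (by simp only [Piece.ins]; omega) rfl)
      (by simp only [Fits, Piece.ins, Piece.outs, List.cons_append, List.nil_append]; omega)
  have h3 : Isotopic m (m - 2)
      [cupAt (p + 2), crossAt false p, crossAt true (p + 1), crossAt false (p + 2), crossAt true p,
        capAt (p + 1), capAt (p + 1), crossAt false p]
      [cupAt (p + 2), crossAt false p, crossAt true (p + 1), crossAt false (p + 2), crossAt true p,
        capAt (p + 3), capAt (p + 1), crossAt false p] :=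
    .step [cupAt (p + 2), crossAt false p, crossAt true (p + 1), crossAt false (p + 2),
        crossAt true p] [crossAt false p]
      (.far (by simp [Piece.ins]) (by simp [Piece.ins, Piece.outs]))
      (by simp only [Fits, Piece.ins, Piece.outs, List.cons_append, List.nil_append]; omega)
      (by simp only [Fits, Piece.ins, Piece.outs, List.cons_append, List.nil_append]; omega)
  have h4 : Isotopic m (m - 2)
      [cupAt (p + 2), crossAt false p, crossAt true (p + 1), crossAt false (p + 2), crossAt true p,
        capAt (p + 3), capAt (p + 1), crossAt false p]
      [cupAt (p + 2), crossAt false p, crossAt true (p + 1), crossAt false (p + 2),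
        capAt (p + 3), crossAt true p, capAt (p + 1), crossAt false p] :=
    .step [cupAt (p + 2), crossAt false p, crossAt true (p + 1), crossAt false (p + 2)]
      [capAt (p + 1), crossAt false p]
      (.far (by simp [Piece.ins]) (by simp [Piece.ins, Piece.outs]))
      (by simp only [Fits, Piece.ins, Piece.outs, List.cons_append, List.nil_append]; omega)
      (by simp only [Fits, Piece.ins, Piece.outs, List.cons_append, List.nil_append]; omega)
  have h5 : Isotopic m (m - 2)
      [cupAt (p + 2), crossAt false p, crossAt true (p + 1), crossAt false (p + 2),
        capAt (p + 3), crossAt true p, capAt (p + 1), crossAt false p]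
      [cupAt (p + 2), crossAt false p, crossAt true (p + 1), crossAt false (p + 2), capAt (p + 3),
        crossAt true (p + 2), crossAt false (p + 1), crossAt true p, crossAt true (p + 1),
        capAt (p + 2)] :=
    (isotopic_tip_cross_right false (p := p) (m := m) (by omega)).context'
      [cupAt (p + 2), crossAt false p, crossAt true (p + 1), crossAt false (p + 2), capAt (p + 3)]
      [] (by simp only [Fits, Piece.ins, Piece.outs]; omega)
      (by simp only [Fits, Piece.ins, Piece.outs, List.cons_append, List.nil_append]; omega)
  exact h1.trans (h2.trans (h3.trans (h4.trans h5)))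

/-- The strand between the tip of a finger and a crossing under the strand to its left passes over
both of them in a curl. -/
theorem isotopic_tip_curl_left {q m : ℕ} (h : q + 4 ≤ m) :
    Isotopic m (m - 2) [crossAt true (q + 1), capAt (q + 2), crossAt true q]
      [cupAt (q + 3), crossAt false (q + 1), crossAt true (q + 2), crossAt false (q + 3),
        capAt (q + 4), crossAt false q, crossAt true (q + 1), crossAt false (q + 2),
        crossAt true q, capAt (q + 1)] := by
  have h1 : Isotopic m (m - 2) [crossAt true (q + 1), capAt (q + 2), crossAt true q]
      [cupAt (q + 3), crossAt true (q + 2), capAt (q + 3), crossAt true (q + 1), capAt (q + 2),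
        crossAt true q] :=
    (isotopic_curl (i := q + 2) (m := m) (by omega)).context' [] _ rfl
      (by simp only [Fits, Piece.ins, Piece.outs, List.nil_append]; omega)
  have h2 : Isotopic m (m - 2)
      [cupAt (q + 3), crossAt true (q + 2), capAt (q + 3), crossAt true (q + 1), capAt (q + 2),
        crossAt true q]
      [cupAt (q + 3), crossAt false (q + 1), crossAt true (q + 2), crossAt false (q + 3),
        crossAt true (q + 1), capAt (q + 2), capAt (q + 2), crossAt true q] :=
    (isotopic_tip_cross_left true (q := q + 1) (m := m + 2) (by omega)).context' [cupAt (q + 3)]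
      [capAt (q + 2), crossAt true q] (fits_single (by simp only [Piece.ins]; omega) rfl)
      (by simp only [Fits, Piece.ins, Piece.outs, List.cons_append, List.nil_append]; omega)
  have h3 : Isotopic m (m - 2)
      [cupAt (q + 3), crossAt false (q + 1), crossAt true (q + 2), crossAt false (q + 3),
        crossAt true (q + 1), capAt (q + 2), capAt (q + 2), crossAt true q]
      [cupAt (q + 3), crossAt false (q + 1), crossAt true (q + 2), crossAt false (q + 3),
        crossAt true (q + 1), capAt (q + 4), capAt (q + 2), crossAt true q] :=
    .step [cupAt (q + 3), crossAt false (q + 1), crossAt true (q + 2), crossAt false (q + 3),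
        crossAt true (q + 1)] [crossAt true q]
      (.far (by simp [Piece.ins]) (by simp [Piece.ins, Piece.outs]))
      (by simp only [Fits, Piece.ins, Piece.outs, List.cons_append, List.nil_append]; omega)
      (by simp only [Fits, Piece.ins, Piece.outs, List.cons_append, List.nil_append]; omega)
  have h4 : Isotopic m (m - 2)
      [cupAt (q + 3), crossAt false (q + 1), crossAt true (q + 2), crossAt false (q + 3),
        crossAt true (q + 1), capAt (q + 4), capAt (q + 2), crossAt true q]
      [cupAt (q + 3), crossAt false (q + 1), crossAt true (q + 2), crossAt false (q + 3),
        capAt (q + 4), crossAt true (q + 1), capAt (q + 2), crossAt true q] :=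
    .step [cupAt (q + 3), crossAt false (q + 1), crossAt true (q + 2), crossAt false (q + 3)]
      [capAt (q + 2), crossAt true q]
      (.far (by simp [Piece.ins]) (by simp [Piece.ins, Piece.outs]))
      (by simp only [Fits, Piece.ins, Piece.outs, List.cons_append, List.nil_append]; omega)
      (by simp only [Fits, Piece.ins, Piece.outs, List.cons_append, List.nil_append]; omega)
  have h5 : Isotopic m (m - 2)
      [cupAt (q + 3), crossAt false (q + 1), crossAt true (q + 2), crossAt false (q + 3),
        capAt (q + 4), crossAt true (q + 1), capAt (q + 2), crossAt true q]
      [cupAt (q + 3), crossAt false (q + 1), crossAt true (q + 2), crossAt false (q + 3),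
        capAt (q + 4), crossAt false q, crossAt true (q + 1), crossAt false (q + 2),
        crossAt true q, capAt (q + 1)] :=
    (isotopic_tip_cross_left true (q := q) (m := m) (by omega)).context'
      [cupAt (q + 3), crossAt false (q + 1), crossAt true (q + 2), crossAt false (q + 3),
        capAt (q + 4)]
      [] (by simp only [Fits, Piece.ins, Piece.outs]; omega)
      (by simp only [Fits, Piece.ins, Piece.outs, List.cons_append, List.nil_append]; omega)
  exact h1.trans (h2.trans (h3.trans (h4.trans h5)))

/-- A crossing with the over strand on the left is the tip of a finger. -/
theorem isotopic_cross_true {p m : ℕ} (h : p + 2 ≤ m) :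
    Isotopic m m [crossAt true p] [cupAt (p + 2), crossAt true p, capAt (p + 1)] := by
  have h1 : Isotopic m m [crossAt true p, cupAt (p + 2), capAt (p + 1)] [crossAt true p] :=
    .step [crossAt true p] [] (.zigzag_right (p + 1))
      (by simp only [Fits, Piece.ins, Piece.outs, List.cons_append, List.nil_append]; omega)
      (by simp only [Fits, Piece.ins, Piece.outs, List.cons_append, List.nil_append]; omega)
  have h2 : Isotopic m m [crossAt true p, cupAt (p + 2), capAt (p + 1)]
      [cupAt (p + 2), crossAt true p, capAt (p + 1)] :=
    .step [] [capAt (p + 1)] (.far (by simp [Piece.ins]) (by simp [Piece.ins, Piece.outs]))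
      (by simp only [Fits, Piece.ins, Piece.outs, List.cons_append, List.nil_append]; omega)
      (by simp only [Fits, Piece.ins, Piece.outs, List.cons_append, List.nil_append]; omega)
  exact h1.symm.trans h2

/-- A crossing with the over strand on the right is the tip of a finger. -/
theorem isotopic_cross_false {p m : ℕ} (h : p + 2 ≤ m) :
    Isotopic m m [crossAt false p] [cupAt p, crossAt true (p + 1), capAt (p + 2)] := by
  have h1 : Isotopic m m [crossAt false p, cupAt p, capAt (p + 1)] [crossAt false p] :=
    .step [crossAt false p] [] (.zigzag_left p)
      (by simp only [Fits, Piece.ins, Piece.outs, List.cons_append, List.nil_append]; omega)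
      (by simp only [Fits, Piece.ins, Piece.outs, List.cons_append, List.nil_append]; omega)
  have h2 : Isotopic m m [cupAt p, crossAt false (p + 2), capAt (p + 1)]
      [crossAt false p, cupAt p, capAt (p + 1)] :=
    .step [] [capAt (p + 1)] (.far (by simp [Piece.ins]) (by simp [Piece.ins, Piece.outs]))
      (by simp only [Fits, Piece.ins, Piece.outs, List.cons_append, List.nil_append]; omega)
      (by simp only [Fits, Piece.ins, Piece.outs, List.cons_append, List.nil_append]; omega)
  have h3 : Isotopic m m [cupAt p, crossAt true (p + 1), capAt (p + 2)]
      [cupAt p, crossAt false (p + 2), capAt (p + 1)] :=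
    .step [cupAt p] [] (.slide_cap true (p + 1))
      (by simp only [Fits, Piece.ins, Piece.outs, List.cons_append, List.nil_append]; omega)
      (by simp only [Fits, Piece.ins, Piece.outs, List.cons_append, List.nil_append]; omega)
  exact h1.symm.trans (h2.symm.trans h3.symm)

theorem ins_cap : Piece.cap.ins = 2 := rfl

theorem outs_cap : Piece.cap.outs = 0 := rfl

theorem ins_cross (b : Bool) : (Piece.cross b).ins = 2 := rfl

theorem outs_cross (b : Bool) : (Piece.cross b).outs = 2 := rfl

/-- The tip of a finger slides past a piece to its left. -/
theorem isotopic_tip_left (s : Piece) {i p m : ℕ} (hi : i + s.ins ≤ p) (h : p + 3 ≤ m) :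
    Isotopic m (m - 2 - s.ins + s.outs) [crossAt true p, capAt (p + 1), ⟨s, i⟩]
      [⟨s, i⟩, crossAt true (p - s.ins + s.outs), capAt (p - s.ins + s.outs + 1)] := by
  have h1 : Isotopic m (m - 2 - s.ins + s.outs) [crossAt true p, ⟨s, i⟩,
      capAt (p - s.ins + s.outs + 1)] [crossAt true p, capAt (p + 1), ⟨s, i⟩] :=
    .step [crossAt true p] [] (.far (by omega) (by omega))
      (by simp only [Fits, ins_cap, outs_cap, ins_cross, outs_cross, List.cons_append, List.nil_append]; omega)
      (by simp only [Fits, ins_cap, outs_cap, ins_cross, outs_cross, List.cons_append, List.nil_append]; omega)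
  have h2 : Isotopic m (m - 2 - s.ins + s.outs) [⟨s, i⟩, crossAt true (p - s.ins + s.outs),
      capAt (p - s.ins + s.outs + 1)] [crossAt true p, ⟨s, i⟩, capAt (p - s.ins + s.outs + 1)] :=
    .step [] [capAt (p - s.ins + s.outs + 1)] (.far (by omega) (by omega))
      (by simp only [Fits, ins_cap, outs_cap, ins_cross, outs_cross, List.cons_append, List.nil_append]; omega)
      (by simp only [Fits, ins_cap, outs_cap, ins_cross, outs_cross, List.cons_append, List.nil_append]; omega)
  exact (h2.trans h1).symm

/-- The tip of a finger slides past a piece to its right. -/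
theorem isotopic_tip_right (s : Piece) {i p m : ℕ} (hi : p + 1 ≤ i) (h : i + 2 + s.ins ≤ m) :
    Isotopic m (m - 2 - s.ins + s.outs) [crossAt true p, capAt (p + 1), ⟨s, i⟩]
      [⟨s, i + 2⟩, crossAt true p, capAt (p + 1)] := by
  have h1 : Isotopic m (m - 2 - s.ins + s.outs) [crossAt true p, capAt (p + 1), ⟨s, i⟩]
      [crossAt true p, ⟨s, i + 2⟩, capAt (p + 1)] :=
    .step [crossAt true p] [] (.far (by simp [Piece.ins]; omega) (by simp [Piece.ins, Piece.outs]))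
      (by simp only [Fits, ins_cap, outs_cap, ins_cross, outs_cross, List.cons_append, List.nil_append]; omega)
      (by simp only [Fits, ins_cap, outs_cap, ins_cross, outs_cross, List.cons_append, List.nil_append]; omega)
  have h2 : Isotopic m (m - 2 - s.ins + s.outs) [crossAt true p, ⟨s, i + 2⟩, capAt (p + 1)]
      [⟨s, i + 2⟩, crossAt true p, capAt (p + 1)] :=
    .step [] [capAt (p + 1)] (.far (by simp [Piece.ins]; omega) (by simp [Piece.ins, Piece.outs]))
      (by simp only [Fits, ins_cap, outs_cap, ins_cross, outs_cross, List.cons_append, List.nil_append]; omega)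
      (by simp only [Fits, ins_cap, outs_cap, ins_cross, outs_cross, List.cons_append, List.nil_append]; omega)
  exact h1.trans h2

/-! ### Removing the largest colour of a simple colouring -/

/-- The colours of the piece lie between `0` and `n`, and they differ by at most `1` at a
crossing. -/
def Core.IsSimple (n : ℤ) : Core → Prop
  | .cup x => 0 ≤ x ∧ x ≤ n
  | .cap x => 0 ≤ x ∧ x ≤ n
  | .cross _ a o => (0 ≤ a ∧ a ≤ n) ∧ (0 ≤ o ∧ o ≤ n) ∧ (0 ≤ 2 * a - o ∧ 2 * a - o ≤ n) ∧
      a - o ≤ 1 ∧ o - a ≤ 1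

/-- The weight of a piece, which is positive if the colour `n` occurs in it. -/
def Core.weight (n : ℤ) : Core → ℕ
  | .cup x => if x = n then 3 else 0
  | .cap x => if x = n then 3 else 0
  | .cross _ a o => if a = n then 3 else if o = n ∨ 2 * a - o = n then 1 else 0

/-- The weight of a coloured word. -/
def weight (n : ℤ) (W : List CSlice) : ℕ := (W.map fun s => s.core.weight n).sum

/-- At some crossing of the word there are at least two colours. -/
def IsPolychromatic (W : List CSlice) : Prop :=
  ∃ s ∈ W, ∃ b a o, s.core = .cross b a o ∧ a ≠ o

@[simp] theorem weight_nil (n : ℤ) : weight n [] = 0 := rfl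

@[simp] theorem weight_cons (n : ℤ) (s : CSlice) (W : List CSlice) :
    weight n (s :: W) = s.core.weight n + weight n W := by
  simp [weight]

@[simp] theorem weight_append (n : ℤ) (U V : List CSlice) :
    weight n (U ++ V) = weight n U + weight n V := by
  simp [weight]

theorem Core.weight_cup_of_ne {n x : ℤ} (h : x ≠ n) : (Core.cup x).weight n = 0 := if_neg h

theorem Core.weight_cap_of_ne {n x : ℤ} (h : x ≠ n) : (Core.cap x).weight n = 0 := if_neg h

theorem Core.weight_cap_self (n : ℤ) : (Core.cap n).weight n = 3 := if_pos rfl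

theorem Core.weight_cross_self (n o : ℤ) (b : Bool) : (Core.cross b n o).weight n = 3 := if_pos rfl

theorem Core.weight_cross_of_ne {n a o : ℤ} (b : Bool) (h : a ≠ n) (h' : o ≠ n)
    (h'' : 2 * a - o ≠ n) : (Core.cross b a o).weight n = 0 := by
  simp [Core.weight, h, h', h'']

theorem Core.weight_cross_under {n a o : ℤ} (b : Bool) (h : a ≠ n) (h' : o = n ∨ 2 * a - o = n) :
    (Core.cross b a o).weight n = 1 := by
  simp [Core.weight, h, h']

/-- The tangle `w` with the colours `c` below and `d` above has a diagram with a simple colouring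
whose weight is less than `k`. -/
def HasLighter (n : ℤ) (c d : List ℤ) (w : List Slice) (k : ℕ) : Prop :=
  ∃ W, Chain W c d ∧ (∀ s ∈ W, s.core.IsSimple n) ∧ IsPolychromatic W ∧ weight n W < k ∧
    Isotopic c.length d.length w (word W)

theorem HasLighter.congr {n : ℤ} {c d : List ℤ} {w w' : List Slice} {k k' : ℕ}
    (h : HasLighter n c d w' k') (hw : Isotopic c.length d.length w w') (hk : k' ≤ k) :
    HasLighter n c d w k := by
  obtain ⟨W, h1, h2, h3, h4, h5⟩ := h
  exact ⟨W, h1, h2, h3, h4.trans_le hk, hw.trans h5⟩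

theorem HasLighter.append {n : ℤ} {c d e : List ℤ} {w : List Slice} {k : ℕ}
    (h : HasLighter n c d w k) {V : List CSlice} (hV : Chain V d e)
    (hs : ∀ s ∈ V, s.core.IsSimple n) : HasLighter n c e (w ++ word V) (k + weight n V) := by
  obtain ⟨W, h1, h2, ⟨s, hs', h3⟩, h4, h5⟩ := h
  refine ⟨W ++ V, h1.append hV, fun s hsW => ?_, ⟨s, by simp [hs'], h3⟩, ?_, ?_⟩
  · exact (List.mem_append.1 hsW).elim (h2 s) (hs s)
  · simpa using h4
  · simpa using h5.append (.refl hV.fits)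

theorem HasLighter.prepend {n : ℤ} {c d e : List ℤ} {w : List Slice} {k : ℕ}
    (h : HasLighter n c d w k) {U : List CSlice} (hU : Chain U e c)
    (hs : ∀ s ∈ U, s.core.IsSimple n) : HasLighter n e d (word U ++ w) (weight n U + k) := by
  obtain ⟨W, h1, h2, ⟨s, hs', h3⟩, h4, h5⟩ := h
  refine ⟨U ++ W, hU.append h1, fun s hsW => ?_, ⟨s, by simp [hs'], h3⟩, ?_, ?_⟩
  · exact (List.mem_append.1 hsW).elim (hs s) (h2 s)
  · simpa using h4
  · simpa using (Isotopic.refl hU.fits).append h5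

/-! ### Local replacements at the tip of the finger -/

/-- The bound is `1` for the crossing at the old tip plus `3` for the maximum of colour `n`. In the
new word the maximum is doubled and has the colours `n - 1` and `n - 2`, so only the crossing at the
new tip has weight, namely `1`. -/
theorem hasLighter_tip_cap_right {n : ℤ} (hn : 4 ≤ n) (l r : List ℤ) :
    HasLighter n (l ++ (n - 1) :: (n - 2) :: (n - 1) :: n :: r) (l ++ r)
      [crossAt true l.length, capAt (l.length + 1), capAt l.length] 4 := by
  refine ⟨[⟨l ++ [n - 1, n - 2], .cross true (n - 1) n, r⟩, ⟨l ++ [n - 1], .cap (n - 2), (n - 1) :: r⟩,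
    ⟨l, .cap (n - 1), r⟩], ?_, ?_, ⟨_, List.mem_cons_self, _, _, _, rfl, by omega⟩, ?_, ?_⟩
  · simp [Chain, CSlice.bot, CSlice.top, Core.bot, Core.top]
    omega
  · simp [Core.IsSimple]
    omega
  · simp (disch := omega) [Core.weight_cross_under, Core.weight_cap_of_ne]
  · convert isotopic_tip_cap_right (p := l.length) (m := l.length + r.length + 4) (by omega) using 1
    · simp; omega
    · simp
    · simp [CSlice.slice, Core.piece]

theorem hasLighter_tip_cap_left {n : ℤ} (hn : 4 ≤ n) (l r : List ℤ) :
    HasLighter n (l ++ n :: (n - 1) :: (n - 2) :: (n - 1) :: r) (l ++ r)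
      [crossAt true (l.length + 1), capAt (l.length + 2), capAt l.length] 4 := by
  refine ⟨[⟨l, .cross false (n - 1) n, (n - 2) :: (n - 1) :: r⟩, ⟨l ++ [n - 1], .cap (n - 2), (n - 1) :: r⟩,
    ⟨l, .cap (n - 1), r⟩], ?_, ?_, ⟨_, List.mem_cons_self, _, _, _, rfl, by omega⟩, ?_, ?_⟩
  · simp [Chain, CSlice.bot, CSlice.top, Core.bot, Core.top]
    omega
  · simp [Core.IsSimple]
    omega
  · simp (disch := omega) [Core.weight_cross_under, Core.weight_cap_of_ne]
  · convert isotopic_tip_cap_left (q := l.length) (m := l.length + r.length + 4) (by omega) using 1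
    · simp; omega
    · simp
    · simp [CSlice.slice, Core.piece]

/-- The crossing of two strands of colour `n` becomes one of two strands of colour `n - 2`,
surrounded by three crossings under the finger of weight `1` each. That `3` is less than `1 + 3` is
the reason for giving the weight `3` to an over arc of colour `n`. -/
theorem hasLighter_tip_cross_right {n : ℤ} (hn : 4 ≤ n) (b : Bool) (l r : List ℤ) :
    HasLighter n (l ++ (n - 1) :: (n - 2) :: (n - 1) :: n :: r) (l ++ n :: n :: r)
      [crossAt true l.length, capAt (l.length + 1), crossAt b l.length] 4 := by
  refine ⟨[⟨l ++ [n - 1, n - 2], .cross true (n - 1) n, r⟩,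
    ⟨l ++ [n - 1], .cross b (n - 2) (n - 2), (n - 1) :: r⟩,
    ⟨l, .cross true (n - 1) (n - 2), (n - 2) :: (n - 1) :: r⟩,
    ⟨l ++ [n], .cross true (n - 1) (n - 2), (n - 1) :: r⟩,
    ⟨l ++ [n, n], .cap (n - 1), r⟩], ?_, ?_, ⟨_, List.mem_cons_self, _, _, _, rfl, by omega⟩, ?_, ?_⟩
  · cases b
    · simp [Chain, CSlice.bot, CSlice.top, Core.bot, Core.top]
      omega
    · simp [Chain, CSlice.bot, CSlice.top, Core.bot, Core.top]
      omega
  · simp [Core.IsSimple]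
    omega
  · simp (disch := omega) [Core.weight_cross_under, Core.weight_cross_of_ne, Core.weight_cap_of_ne]
  · convert isotopic_tip_cross_right b (p := l.length) (m := l.length + r.length + 4)
      (by omega) using 1
    · simp; omega
    · simp; omega
    · simp [CSlice.slice, Core.piece]

theorem hasLighter_tip_cross_left {n : ℤ} (hn : 4 ≤ n) (b : Bool) (l r : List ℤ) :
    HasLighter n (l ++ n :: (n - 1) :: (n - 2) :: (n - 1) :: r) (l ++ n :: n :: r)
      [crossAt true (l.length + 1), capAt (l.length + 2), crossAt b l.length] 4 := by
  refine ⟨[⟨l, .cross false (n - 1) n, (n - 2) :: (n - 1) :: r⟩,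
    ⟨l ++ [n - 1], .cross b (n - 2) (n - 2), (n - 1) :: r⟩,
    ⟨l ++ [n - 1, n - 2], .cross false (n - 1) (n - 2), r⟩,
    ⟨l, .cross true (n - 1) (n - 2), (n - 1) :: n :: r⟩,
    ⟨l ++ [n], .cap (n - 1), n :: r⟩], ?_, ?_, ⟨_, List.mem_cons_self, _, _, _, rfl, by omega⟩,
    ?_, ?_⟩
  · cases b
    · simp [Chain, CSlice.bot, CSlice.top, Core.bot, Core.top]
      omega
    · simp [Chain, CSlice.bot, CSlice.top, Core.bot, Core.top]
      omega
  · simp [Core.IsSimple]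
    omega
  · simp (disch := omega) [Core.weight_cross_under, Core.weight_cross_of_ne, Core.weight_cap_of_ne]
  · convert isotopic_tip_cross_left b (q := l.length) (m := l.length + r.length + 4)
      (by omega) using 1
    · simp; omega
    · simp; omega
    · simp [CSlice.slice, Core.piece]

/-- Under the curl of colour `n - 2` the two over arcs change from `n - 1` to `n - 3`, and the
segment between them from `n` to `n - 4`. This needs `4 ≤ n`. The colour `n` does not occur in the
new word, whereas both old crossings had weight `1`. -/
theorem hasLighter_tip_curl_right {n : ℤ} (hn : 4 ≤ n) (l r : List ℤ) :
    HasLighter n (l ++ (n - 1) :: (n - 2) :: (n - 1) :: (n - 1) :: r)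
      (l ++ (n - 1) :: (n - 2) :: r)
      [crossAt true l.length, capAt (l.length + 1), crossAt false l.length] 2 := by
  refine ⟨[⟨l ++ [n - 1, n - 2], .cup (n - 2), (n - 1) :: (n - 1) :: r⟩,
    ⟨l, .cross false (n - 2) (n - 1), (n - 2) :: (n - 2) :: (n - 1) :: (n - 1) :: r⟩,
    ⟨l ++ [n - 2], .cross true (n - 3) (n - 2), (n - 2) :: (n - 1) :: (n - 1) :: r⟩,
    ⟨l ++ [n - 2, n - 4], .cross false (n - 2) (n - 3), (n - 1) :: (n - 1) :: r⟩,
    ⟨l ++ [n - 2, n - 4, n - 2], .cap (n - 1), (n - 1) :: r⟩,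
    ⟨l ++ [n - 2, n - 4], .cross true (n - 2) (n - 1), r⟩,
    ⟨l ++ [n - 2], .cross false (n - 3) (n - 4), (n - 2) :: r⟩,
    ⟨l, .cross true (n - 2) (n - 3), (n - 2) :: (n - 2) :: r⟩,
    ⟨l ++ [n - 1], .cross true (n - 2) (n - 2), (n - 2) :: r⟩,
    ⟨l ++ [n - 1, n - 2], .cap (n - 2), r⟩], ?_, ?_,
    ⟨_, List.mem_cons_of_mem _ List.mem_cons_self, _, _, _, rfl, by omega⟩, ?_, ?_⟩
  · simp [Chain, CSlice.bot, CSlice.top, Core.bot, Core.top]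
    omega
  · simp [Core.IsSimple]
    omega
  · simp (disch := omega) [Core.weight_cross_of_ne, Core.weight_cap_of_ne, Core.weight_cup_of_ne]
  · convert isotopic_tip_curl_right (p := l.length) (m := l.length + r.length + 4)
      (by omega) using 1
    · simp; omega
    · simp; omega
    · simp [CSlice.slice, Core.piece]

theorem hasLighter_tip_curl_left {n : ℤ} (hn : 4 ≤ n) (l r : List ℤ) :
    HasLighter n (l ++ (n - 1) :: (n - 1) :: (n - 2) :: (n - 1) :: r)
      (l ++ (n - 2) :: (n - 1) :: r)
      [crossAt true (l.length + 1), capAt (l.length + 2), crossAt true l.length] 2 := by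
  refine ⟨[⟨l ++ [n - 1, n - 1, n - 2], .cup (n - 2), (n - 1) :: r⟩,
    ⟨l ++ [n - 1], .cross false (n - 2) (n - 1), (n - 2) :: (n - 2) :: (n - 1) :: r⟩,
    ⟨l ++ [n - 1, n - 2], .cross true (n - 3) (n - 2), (n - 2) :: (n - 1) :: r⟩,
    ⟨l ++ [n - 1, n - 2, n - 4], .cross false (n - 2) (n - 3), (n - 1) :: r⟩,
    ⟨l ++ [n - 1, n - 2, n - 4, n - 2], .cap (n - 1), r⟩,
    ⟨l, .cross false (n - 2) (n - 1), (n - 4) :: (n - 2) :: r⟩,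
    ⟨l ++ [n - 2], .cross true (n - 3) (n - 4), (n - 2) :: r⟩,
    ⟨l ++ [n - 2, n - 2], .cross false (n - 2) (n - 3), r⟩,
    ⟨l, .cross true (n - 2) (n - 2), (n - 2) :: (n - 1) :: r⟩,
    ⟨l ++ [n - 2], .cap (n - 2), (n - 1) :: r⟩], ?_, ?_,
    ⟨_, List.mem_cons_of_mem _ List.mem_cons_self, _, _, _, rfl, by omega⟩, ?_, ?_⟩
  · simp [Chain, CSlice.bot, CSlice.top, Core.bot, Core.top]
    omega
  · simp [Core.IsSimple]
    omega
  · simp (disch := omega) [Core.weight_cross_of_ne, Core.weight_cap_of_ne, Core.weight_cup_of_ne]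
  · convert isotopic_tip_curl_left (q := l.length) (m := l.length + r.length + 4)
      (by omega) using 1
    · simp; omega
    · simp; omega
    · simp [CSlice.slice, Core.piece]

/-! ### Pushing the finger along a strand -/

/-- The three cases say that the marked strand runs to the right of the piece, to its left, or into
it. -/
theorem append_cons_eq_append_append {α : Type*} {l r l' b r' : List α} {x : α}
    (h : l ++ x :: r = l' ++ (b ++ r')) :
    (∃ e, l = l' ++ (b ++ e) ∧ r' = e ++ x :: r) ∨ (∃ e, l' = l ++ x :: e ∧ r = e ++ (b ++ r')) ∨
      ∃ b₁ b₂, b = b₁ ++ x :: b₂ ∧ l = l' ++ b₁ ∧ r = b₂ ++ r' := by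
  obtain ⟨e, h1, h2⟩ | ⟨e, h1, h2⟩ := List.append_eq_append_iff.1 h
  · cases e with
    | nil =>
      simp only [List.append_nil, List.nil_append] at h1 h2
      subst h1
      cases b with
      | nil => exact .inl ⟨[], by simp, by simpa using h2.symm⟩
      | cons y b =>
        simp only [List.cons_append, List.cons.injEq] at h2
        exact .inr (.inr ⟨[], b, by simp [h2.1], by simp, h2.2⟩)
    | cons y e =>
      simp only [List.cons_append, List.cons.injEq] at h2
      exact .inr (.inl ⟨e, by rw [h1, h2.1], h2.2⟩)
  · obtain ⟨f, h3, h4⟩ | ⟨f, h3, h4⟩ := List.append_eq_append_iff.1 h2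
    · exact .inl ⟨f, by rw [h1, h3], h4⟩
    · cases f with
      | nil => exact .inl ⟨[], by simp_all, by simpa using h4.symm⟩
      | cons y f =>
        simp only [List.cons_append, List.cons.injEq] at h4
        exact .inr (.inr ⟨e, f, by rw [h3, h4.1], h1, h4.2⟩)

theorem append_cons_eq_pair {α : Type*} {b₁ b₂ : List α} {x y z : α}
    (h : [x, y] = b₁ ++ z :: b₂) : (b₁ = [] ∧ z = x ∧ b₂ = [y]) ∨ (b₁ = [x] ∧ z = y ∧ b₂ = []) := by
  rcases b₁ with _ | ⟨a, _ | ⟨b, b₁⟩⟩ <;> simp_all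

/-- A finger over a strand of the colour `n` is pushed along this strand, until a piece of positive
weight is removed. -/
theorem hasLighter_push {n : ℤ} (hn : 4 ≤ n) (V : List CSlice) (l r : List ℤ)
    (hV : Chain V (l ++ n :: r) []) (hs : ∀ s ∈ V, s.core.IsSimple n) :
    HasLighter n (l ++ (n - 1) :: (n - 2) :: (n - 1) :: r) []
      (crossAt true l.length :: capAt (l.length + 1) :: word V) (1 + weight n V) := by
  have hfits := hV.fits
  induction V generalizing l r with
  -- The strand cannot end in the air, so the push meets a piece on it before the word is exhausted.
  | nil => simp [Chain] at hV
  | cons s V ih =>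
    obtain ⟨sl, k, sr⟩ := s
    obtain ⟨h, hV⟩ := hV
    have hk : k.IsSimple n := hs _ List.mem_cons_self
    replace hs : ∀ s ∈ V, s.core.IsSimple n := fun s h => hs s (by simp [h])
    have hVf := hV.fits
    have hF : Fits (crossAt true l.length :: capAt (l.length + 1) :: word (⟨sl, k, sr⟩ :: V))
        (l ++ (n - 1) :: (n - 2) :: (n - 1) :: r).length ([] : List ℤ).length := by
      refine fits_cross_cons ?_ (fits_cons ?_ ?_)
      · simp
      · simp [Piece.ins]
        omega
      · convert hfits using 1
        simp [Piece.ins, Piece.outs]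
        omega
    obtain ⟨e, rfl, rfl⟩ | ⟨e, rfl, rfl⟩ | ⟨b₁, b₂, hb, rfl, rfl⟩ :=
      append_cons_eq_append_append h
    · have hV' : Chain V ((sl ++ (k.top ++ e)) ++ n :: r) [] := by
        simpa [CSlice.top] using hV
      have h1 := (ih _ _ hV' hs hV'.fits).prepend
        (U := [⟨sl, k, e ++ (n - 1) :: (n - 2) :: (n - 1) :: r⟩])
        (e := sl ++ (k.bot ++ e) ++ (n - 1) :: (n - 2) :: (n - 1) :: r)
        (by simp [Chain, CSlice.bot, CSlice.top]) (by simpa using hk)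
      refine h1.congr ?_ (by simp; omega)
      have h2 := (isotopic_tip_left k.piece (i := sl.length) (p := (sl ++ (k.bot ++ e)).length)
        (m := (sl ++ (k.bot ++ e) ++ (n - 1) :: (n - 2) :: (n - 1) :: r).length)
        (by simp) (by simp; omega)).context' [] (word V) rfl hF
      have e1 : (sl ++ (k.bot ++ e)).length - k.piece.ins + k.piece.outs =
          (sl ++ (k.top ++ e)).length := by
        simp only [List.length_append, Core.length_bot, Core.length_top]
        omega
      rw [e1] at h2
      exact h2
    · have hV' : Chain V (l ++ n :: (e ++ (k.top ++ sr))) [] := by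
        simpa [CSlice.top] using hV
      have h1 := (ih _ _ hV' hs hV'.fits).prepend
        (U := [⟨l ++ (n - 1) :: (n - 2) :: (n - 1) :: e, k, sr⟩])
        (e := l ++ (n - 1) :: (n - 2) :: (n - 1) :: (e ++ (k.bot ++ sr)))
        (by simp [Chain, CSlice.bot, CSlice.top]) (by simpa using hk)
      refine h1.congr ?_ (by simp; omega)
      have h2 := (isotopic_tip_right k.piece (i := (l ++ n :: e).length) (p := l.length)
        (m := (l ++ (n - 1) :: (n - 2) :: (n - 1) :: (e ++ (k.bot ++ sr))).length)
        (by simp) (by simp; omega)).context' [] (word V) rfl hF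
      have e1 : (l ++ n :: e).length + 2 = (l ++ (n - 1) :: (n - 2) :: (n - 1) :: e).length := by
        simp
        omega
      rw [e1] at h2
      exact h2
    · have key : ∀ {c d : List ℤ} {x : ℕ},
          HasLighter n c d [crossAt true (sl ++ b₁).length, capAt ((sl ++ b₁).length + 1),
            CSlice.slice ⟨sl, k, sr⟩] x →
          c = sl ++ b₁ ++ (n - 1) :: (n - 2) :: (n - 1) :: (b₂ ++ sr) → d = sl ++ (k.top ++ sr) →
          x ≤ 1 + k.weight n →
          HasLighter n (sl ++ b₁ ++ (n - 1) :: (n - 2) :: (n - 1) :: (b₂ ++ sr)) []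
            (crossAt true (sl ++ b₁).length :: capAt ((sl ++ b₁).length + 1) ::
              word (⟨sl, k, sr⟩ :: V)) (1 + weight n (⟨sl, k, sr⟩ :: V)) := by
        rintro c d x h rfl rfl hx
        refine (h.append hV hs).congr (.refl hF) ?_
        simp only [weight_cons]
        omega
      cases k with
      | cup x => simp [Core.bot] at hb
      | cap x =>
        obtain ⟨rfl, rfl, rfl⟩ | ⟨rfl, rfl, rfl⟩ := append_cons_eq_pair hb
        · refine key (c := _) (d := sl ++ sr) (x := 4) ?_ rfl rfl
            (by rw [Core.weight_cap_self])
          simpa [CSlice.slice, Core.piece] using hasLighter_tip_cap_right hn sl sr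
        · refine key (c := _) (d := sl ++ sr) (x := 4) ?_ rfl rfl
            (by rw [Core.weight_cap_self])
          simpa [CSlice.slice, Core.piece] using hasLighter_tip_cap_left hn sl sr
      | cross b a o =>
        obtain ⟨ha, ho, ho', hao, hoa⟩ := hk
        cases b with
        | true =>
          obtain ⟨rfl, rfl, rfl⟩ | ⟨rfl, rfl, rfl⟩ := append_cons_eq_pair hb
          -- An over arc of the largest colour forces `o = n`, since neither `o` nor `2 * n - o`
          -- exceeds `n`.
          · obtain rfl : o = n := by omega
            refine key (c := _) (d := sl ++ o :: o :: sr) (x := 4) ?_ rfl ?_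
              (by rw [Core.weight_cross_self])
            · simpa [CSlice.slice, Core.piece] using hasLighter_tip_cross_right hn true sl sr
            · simp [Core.top]
              omega
          -- The strand passes under here. If the over arc has the colour `n`, the finger goes on
          -- through the crossing; if it has the colour `n - 1`, the curl is needed.
          · obtain rfl | rfl : a = n ∨ a = n - 1 := by omega
            · refine key (c := _) (d := sl ++ a :: a :: sr) (x := 4) ?_ rfl ?_
                (by rw [Core.weight_cross_self])
              · simpa [CSlice.slice, Core.piece] using hasLighter_tip_cross_left hn true sl sr
              · simp [Core.top]
                omega
            · refine key (c := _) (d := sl ++ (n - 2) :: (n - 1) :: sr) (x := 2) ?_ rfl ?_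
                (by rw [Core.weight_cross_under _ (by omega) (.inl rfl)])
              · simpa [CSlice.slice, Core.piece] using hasLighter_tip_curl_left hn sl sr
              · simp [Core.top]
                omega
        | false =>
          obtain ⟨rfl, rfl, rfl⟩ | ⟨rfl, rfl, rfl⟩ := append_cons_eq_pair hb
          · obtain rfl | rfl : a = n ∨ a = n - 1 := by omega
            · refine key (c := _) (d := sl ++ a :: a :: sr) (x := 4) ?_ rfl ?_
                (by rw [Core.weight_cross_self])
              · simpa [CSlice.slice, Core.piece] using hasLighter_tip_cross_right hn false sl sr
              · simp [Core.top]
                omega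
            · refine key (c := _) (d := sl ++ (n - 1) :: (n - 2) :: sr) (x := 2) ?_ rfl ?_
                (by rw [Core.weight_cross_under _ (by omega) (.inl rfl)])
              · simpa [CSlice.slice, Core.piece] using hasLighter_tip_curl_right hn sl sr
              · simp [Core.top]
                omega
          · obtain rfl : o = n := by omega
            refine key (c := _) (d := sl ++ o :: o :: sr) (x := 4) ?_ rfl ?_
              (by rw [Core.weight_cross_self])
            · simpa [CSlice.slice, Core.piece] using hasLighter_tip_cross_left hn false sl sr
            · simp [Core.top]
              omega

/-- A minimum of colour `n - 1`, which has weight `0`, turns the over strand of the crossing into a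
finger. The crossing itself is its tip and accounts for the `1` in `hasLighter_push`. -/
theorem hasLighter_of_top {n : ℤ} (hn : 4 ≤ n) {W : List CSlice} (hW : Chain W [] [])
    (hs : ∀ s ∈ W, s.core.IsSimple n) {t : CSlice} (ht : t ∈ W) {b : Bool} {a o : ℤ}
    (hcore : t.core = .cross b a o) (ha : a ≠ n) (ho : 2 * a - o = n) :
    HasLighter n [] [] (word W) (weight n W) := by
  obtain ⟨U, V, rfl⟩ := List.append_of_mem ht
  obtain ⟨c, hU, rfl, hV⟩ := chain_append.1 hW
  have hk := hs t ht
  obtain ⟨l, k, r⟩ := t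
  simp only at hcore
  subst hcore
  have hVs : ∀ s ∈ V, s.core.IsSimple n := fun s h => hs s (by simp [h])
  obtain ⟨hk1, hk2, hk3, hk4, hk5⟩ := hk
  -- The differences `n - a` and `a - o` agree and are at most `1`, and `a` is less than `n`.
  obtain rfl : a = n - 1 := by omega
  obtain rfl : o = n - 2 := by omega
  suffices h : HasLighter n (CSlice.bot ⟨l, .cross b (n - 1) (n - 2), r⟩) []
      (word (⟨l, .cross b (n - 1) (n - 2), r⟩ :: V)) (1 + weight n V) by
    have := h.prepend hU fun s h => hs s (by simp [h])
    rw [← word_append] at this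
    refine this.congr (.refl hW.fits) ?_
    simp [Core.weight_cross_under b ha (.inr ho)]
  have hfits : Fits (word (⟨l, .cross b (n - 1) (n - 2), r⟩ :: V))
      (CSlice.bot ⟨l, .cross b (n - 1) (n - 2), r⟩).length ([] : List ℤ).length :=
    Chain.fits ⟨rfl, hV⟩
  cases b with
  | true =>
    have hV' : Chain V (l ++ n :: (n - 1) :: r) [] := by
      simpa [CSlice.top, Core.top, ho] using hV
    have h1 := (hasLighter_push hn V l ((n - 1) :: r) hV' hVs).prepend
      (U := [⟨l ++ [n - 1, n - 2], .cup (n - 1), r⟩]) (e := l ++ (n - 1) :: (n - 2) :: r)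
      (by simp [Chain, CSlice.bot, CSlice.top, Core.bot, Core.top]) (by simp [Core.IsSimple]; omega)
    refine h1.congr ?_ ?_
    · have h2 := (isotopic_cross_true (p := l.length)
        (m := (CSlice.bot ⟨l, .cross true (n - 1) (n - 2), r⟩).length)
        (by simp [CSlice.bot, Core.bot])).context' [] (word V) rfl hfits
      simpa [CSlice.bot, CSlice.slice, Core.bot, Core.piece] using h2
    · simp (disch := omega) [Core.weight_cup_of_ne]
  | false =>
    have hV' : Chain V ((l ++ [n - 1]) ++ n :: r) [] := by
      simpa [CSlice.top, Core.top, ho] using hV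
    have h1 := (hasLighter_push hn V (l ++ [n - 1]) r hV' hVs).prepend
      (U := [⟨l, .cup (n - 1), (n - 2) :: (n - 1) :: r⟩]) (e := l ++ (n - 2) :: (n - 1) :: r)
      (by simp [Chain, CSlice.bot, CSlice.top, Core.bot, Core.top]) (by simp [Core.IsSimple]; omega)
    refine h1.congr ?_ ?_
    · have h2 := (isotopic_cross_false (p := l.length)
        (m := (CSlice.bot ⟨l, .cross false (n - 1) (n - 2), r⟩).length)
        (by simp [CSlice.bot, Core.bot])).context' [] (word V) rfl hfits
      simpa [CSlice.bot, CSlice.slice, Core.bot, Core.piece] using h2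
    · simp (disch := omega) [Core.weight_cup_of_ne]

/-! ### Turning coloured words upside down -/

/-- A coloured piece upside down. -/
def Core.flip : Core → Core
  | .cup x => .cap x
  | .cap x => .cup x
  | .cross b a o => .cross (!b) a (2 * a - o)

/-- A coloured slice upside down. -/
def CSlice.flip (s : CSlice) : CSlice := ⟨s.l, s.core.flip, s.r⟩

/-- A coloured word upside down. -/
def flipColored (W : List CSlice) : List CSlice := (W.map CSlice.flip).reverse

theorem Core.flip_bot (k : Core) : k.flip.bot = k.top := by
  rcases k with _ | _ | ⟨_ | _, _, _⟩ <;> simp [Core.flip, Core.bot, Core.top]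

theorem Core.flip_top (k : Core) : k.flip.top = k.bot := by
  rcases k with _ | _ | ⟨_ | _, _, _⟩ <;> simp [Core.flip, Core.bot, Core.top]

theorem Core.flip_piece (k : Core) : k.flip.piece = k.piece.flip := by
  cases k <;> rfl

theorem Core.IsSimple.flip {n : ℤ} {k : Core} (h : k.IsSimple n) : k.flip.IsSimple n := by
  cases k with
  | cup x => exact h
  | cap x => exact h
  | cross b a o =>
    simp only [Core.IsSimple, Core.flip] at h ⊢
    omega

theorem Core.weight_flip (n : ℤ) (k : Core) : k.flip.weight n = k.weight n := by
  cases k with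
  | cup x => rfl
  | cap x => rfl
  | cross b a o => simp [Core.weight, Core.flip, or_comm]

theorem word_flipColored (W : List CSlice) : word (flipColored W) = flipWord (word W) := by
  simp [word, flipColored, flipWord, Function.comp_def, CSlice.slice, CSlice.flip, Core.flip_piece]

theorem weight_flipColored (n : ℤ) (W : List CSlice) : weight n (flipColored W) = weight n W := by
  simp [weight, flipColored, Function.comp_def, CSlice.flip, Core.weight_flip, List.sum_reverse]

theorem mem_flipColored {W : List CSlice} {s : CSlice} :
    s ∈ flipColored W ↔ ∃ t ∈ W, t.flip = s := by
  simp [flipColored]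

theorem Chain.flip {W : List CSlice} {c d : List ℤ} (h : Chain W c d) :
    Chain (flipColored W) d c := by
  induction W generalizing c with
  | nil => exact h.symm
  | cons s W ih =>
    obtain ⟨rfl, h⟩ := h
    have : flipColored (s :: W) = flipColored W ++ [s.flip] := by simp [flipColored]
    rw [this]
    exact (ih h).append ⟨by simp [CSlice.top, CSlice.bot, CSlice.flip, Core.flip_bot],
      by simp [CSlice.top, CSlice.bot, CSlice.flip, Core.flip_top, Chain]⟩

theorem HasLighter.flip {n : ℤ} {c d : List ℤ} {w : List Slice} {k : ℕ}
    (h : HasLighter n c d w k) : HasLighter n d c (flipWord w) k := by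
  obtain ⟨W, h1, h2, ⟨s, hs, b, a, o, hc, hao⟩, h4, h5⟩ := h
  refine ⟨flipColored W, h1.flip, ?_, ⟨s.flip, mem_flipColored.2 ⟨s, hs, rfl⟩, !b, a, 2 * a - o,
    ?_, by omega⟩, by rwa [weight_flipColored], by simpa [word_flipColored] using h5.flip⟩
  · intro t ht
    obtain ⟨t, htW, rfl⟩ := mem_flipColored.1 ht
    exact (h2 t htW).flip
  · simp [CSlice.flip, hc, Core.flip]

/-- If the colour `n` occurs at a crossing with other colours, then the weight can be lowered. -/
theorem hasLighter_of_mem {n : ℤ} (hn : 4 ≤ n) {W : List CSlice} (hW : Chain W [] [])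
    (hs : ∀ s ∈ W, s.core.IsSimple n) {t : CSlice} (ht : t ∈ W) {b : Bool} {a o : ℤ}
    (hcore : t.core = .cross b a o) (ha : a ≠ n) (ho : o = n ∨ 2 * a - o = n) :
    HasLighter n [] [] (word W) (weight n W) := by
  obtain ho | ho := ho
  -- Turned upside down, the under arc of colour `n` leaves the crossing at the top.
  · have h := hasLighter_of_top hn hW.flip (t := t.flip) (b := !b) (a := a) (o := 2 * a - o)
      (fun s hs' => ?_) (mem_flipColored.2 ⟨t, ht, rfl⟩) (by simp [CSlice.flip, hcore, Core.flip])
      ha (by omega)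
    · simpa [word_flipColored, weight_flipColored] using h.flip
    · obtain ⟨s, hsW, rfl⟩ := mem_flipColored.1 hs'
      exact (hs s hsW).flip
  · exact hasLighter_of_top hn hW hs ht hcore ha ho

/-! ### Descent on the weight and on the largest colour -/

theorem Core.exists_color_of_weight_pos {n : ℤ} {k : Core} (h : 0 < k.weight n)
    (h' : ∀ b a o, k = .cross b a o → a ≠ n → ¬ (o = n ∨ 2 * a - o = n)) :
    n ∈ k.bot ++ k.top := by
  cases k with
  | cup x =>
    by_cases hx : x = n
    · simp [hx, Core.top]
    · simp [Core.weight, hx] at h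
  | cap x =>
    by_cases hx : x = n
    · simp [hx, Core.bot]
    · simp [Core.weight, hx] at h
  | cross b a o =>
    by_cases ha : a = n
    · cases b <;> simp [ha, Core.bot]
    · simp [Core.weight, ha, h' b a o rfl ha] at h

theorem Core.IsSimple.pred {n : ℤ} {k : Core} (h : k.IsSimple n) (h' : k.weight n = 0) :
    k.IsSimple (n - 1) := by
  cases k with
  | cup x =>
    simp only [Core.IsSimple, Core.weight, ite_eq_right_iff, OfNat.ofNat_ne_zero, imp_false]
      at h h' ⊢
    omega
  | cap x =>
    simp only [Core.IsSimple, Core.weight, ite_eq_right_iff, OfNat.ofNat_ne_zero, imp_false]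
      at h h' ⊢
    omega
  | cross b a o =>
    by_cases ha : a = n
    · simp [Core.weight, ha] at h'
    · simp only [Core.weight, ha, if_false, ite_eq_right_iff, one_ne_zero, imp_false] at h'
      simp only [Core.IsSimple] at h ⊢
      omega

/-- A simple colouring of a diagram of a link that is not splittable can be replaced by one without
the largest colour `n`, if `n` is at least `4`. -/
theorem exists_isSimple_pred {n : ℤ} (hn : 4 ≤ n) {D : Diagram} (hD : ¬ D.link.IsSplittable)
    {W : List CSlice} (hW : Chain W [] []) (hDW : D.slices = word W)
    (hs : ∀ s ∈ W, s.core.IsSimple n) (hp : IsPolychromatic W) :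
    ∃ (E : Diagram) (V : List CSlice), E.link = D.link ∧ Chain V [] [] ∧ E.slices = word V ∧
      (∀ s ∈ V, s.core.IsSimple (n - 1)) ∧ IsPolychromatic V := by
  induction h : weight n W using Nat.strong_induction_on generalizing D W with
  | _ k ih =>
    subst h
    by_cases hm : ∃ t ∈ W, ∃ b a o, t.core = .cross b a o ∧ a ≠ n ∧ (o = n ∨ 2 * a - o = n)
    · obtain ⟨t, ht, b, a, o, hcore, ha, ho⟩ := hm
      obtain ⟨V, h1, h2, h3, h4, h5⟩ := hasLighter_of_mem hn hW hs ht hcore ha ho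
      let E : Diagram := ⟨word V, h1.fits⟩
      have hE : D.link = E.link := Isotopic.link_eq (by rw [hDW]; exact h5)
      rw [hE] at hD ⊢
      exact ih _ h4 hD h1 rfl h2 h3 rfl
    · push Not at hm
      have hzero : ∀ s ∈ W, s.core.weight n = 0 := by
        by_contra! hpos
        obtain ⟨s, hsW, hpos⟩ := hpos
        -- No crossing has both `n` and another colour: by `hm` if the over arc is not `n`, and by
        -- maximality of `n` if it is. So strands of colour `n` would split off.
        refine hD (hW.isSplittable (fun x => decide (x = n)) hDW ?_ ⟨s, hsW, n, ?_, by simp⟩ ?_)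
        · intro t ht b a o hcore
          have h1 := hm t ht b a o hcore
          have h2 := hs t ht
          rw [hcore] at h2
          obtain ⟨hk1, hk2, hk3, hk4, hk5⟩ := h2
          by_cases ha : a = n
          · simp only [decide_eq_decide, ne_eq, decide_eq_true_eq]
            omega
          · have := h1 ha
            simp only [decide_eq_decide, ne_eq, decide_eq_true_eq]
            omega
        · refine Core.exists_color_of_weight_pos (Nat.pos_of_ne_zero hpos) fun b a o hc ha => ?_
          simpa using hm s hsW b a o hc ha
        -- A crossing with at least two colours supplies a strand whose colour is not `n`.
        · obtain ⟨t, ht, b, a, o, hcore, hao⟩ := hp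
          by_cases ha : a = n
          · exact ⟨t, ht, o, by cases b <;> simp [hcore, Core.bot], by simp; omega⟩
          · exact ⟨t, ht, a, by cases b <;> simp [hcore, Core.bot], by simp [ha]⟩
      exact ⟨D, W, rfl, hW, hDW, fun s h => (hs s h).pred (hzero s h), hp⟩

/-- A link that is not splittable and has a simple colouring has one with the colours `0`, `1`, `2`
and `3` at most. -/
theorem exists_isSimple_three (n : ℕ) {D : Diagram} (hD : ¬ D.link.IsSplittable)
    {W : List CSlice} (hW : Chain W [] []) (hDW : D.slices = word W)
    (hs : ∀ s ∈ W, s.core.IsSimple n) (hp : IsPolychromatic W) :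
    ∃ (E : Diagram) (V : List CSlice), E.link = D.link ∧ Chain V [] [] ∧ E.slices = word V ∧
      (∀ s ∈ V, s.core.IsSimple 3) ∧ IsPolychromatic V := by
  induction n generalizing D W with
  | zero =>
    refine ⟨D, W, rfl, hW, hDW, fun s h => ?_, hp⟩
    have := hs s h
    revert this
    cases s.core <;> simp only [Core.IsSimple] <;> omega
  | succ n ih =>
    by_cases hn : n + 1 ≤ 3
    · refine ⟨D, W, rfl, hW, hDW, fun s h => ?_, hp⟩
      have := hs s h
      revert this
      cases s.core <;> simp only [Core.IsSimple] <;> omega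
    · obtain ⟨E, V, h1, h2, h3, h4, h5⟩ := exists_isSimple_pred (by omega) hD hW hDW hs hp
      rw [← h1] at hD ⊢
      exact ih hD h2 h3 (by simpa using h4) h5

/-! ### Coloured words from colourings -/

theorem strandsAfter_append (u v : List Slice) (m : ℕ) :
    strandsAfter (u ++ v) m = strandsAfter v (strandsAfter u m) := by
  induction u generalizing m with
  | nil => rfl
  | cons s u ih => exact ih _

theorem Fits.strandsAfter_eq {w : List Slice} {m n : ℕ} (h : Fits w m n) :
    strandsAfter w m = n := by
  induction w generalizing m with
  | nil => exact h
  | cons s w ih => exact ih h.2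

namespace Diagram

variable (D : Diagram)

/-- The number of strands above the first `k` slices. -/
def strands (k : ℕ) : ℕ := strandsAfter (D.slices.take k) 0

theorem strands_zero : D.strands 0 = 0 := rfl

theorem strands_length : D.strands D.slices.length = 0 := by
  rw [strands, List.take_length, D.fits.strandsAfter_eq]

theorem take_succ_eq {k : ℕ} {s : Slice} (hs : D.slices[k]? = some s) :
    D.slices.take (k + 1) = D.slices.take k ++ [s] := by
  rw [List.take_add_one, hs]
  rfl

theorem strands_succ {k : ℕ} {s : Slice} (hs : D.slices[k]? = some s) :
    D.strands (k + 1) = D.strands k - s.piece.ins + s.piece.outs := by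
  rw [strands, D.take_succ_eq hs, strandsAfter_append]
  rfl

theorem pos_add_ins_le {k : ℕ} {s : Slice} (hs : D.slices[k]? = some s) :
    s.pos + s.piece.ins ≤ D.strands k := by
  have h := D.fits
  rw [← List.take_append_drop (k + 1) D.slices, D.take_succ_eq hs, List.append_assoc] at h
  obtain ⟨l, h1, h2⟩ := fits_append.1 h
  rw [strands, h1.strandsAfter_eq]
  exact h2.1

instance : Finite D.Point := by
  refine Finite.of_injective
    (β := Σ k : Fin (D.slices.length + 1), Fin (D.strands k))
    (fun x => ⟨⟨x.1.1, Nat.lt_succ_of_le x.2.1⟩, ⟨x.1.2, x.2.2⟩⟩) ?_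
  rintro ⟨⟨k, j⟩, h⟩ ⟨⟨k', j'⟩, h'⟩ he
  simp only [Sigma.mk.injEq, Fin.mk.injEq] at he
  obtain ⟨rfl, he⟩ := he
  obtain rfl : j = j' := congrArg Fin.val (eq_of_heq he)
  rfl

instance : Finite D.Arc := Quotient.finite _

variable {D}

open Classical in
/-- The colour of a point, with the value `0` outside of the diagram. -/
noncomputable def colorAt (γ : D.Arc → ℤ) (k j : ℕ) : ℤ :=
  if h : k ≤ D.slices.length ∧ j < D.strands k then γ (D.arc ⟨(k, j), h⟩) else 0

/-- The colours above the first `k` slices. -/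
noncomputable def colors (γ : D.Arc → ℤ) (k : ℕ) : List ℤ :=
  (List.range (D.strands k)).map (colorAt γ k)

theorem colorAt_eq (γ : D.Arc → ℤ) (x : D.Point) {k j : ℕ} (hx : x.1 = (k, j)) :
    colorAt γ k j = γ (D.arc x) := by
  obtain ⟨y, hy⟩ := x
  subst hx
  exact dif_pos hy

theorem exists_point {k j : ℕ} (hk : k ≤ D.slices.length) (hj : j < D.strands k) :
    ∃ x : D.Point, x.1 = (k, j) := ⟨⟨(k, j), hk, hj⟩, rfl⟩

theorem colorAt_eq_of_joined (γ : D.Arc → ℤ) {k j k' j' : ℕ} {x y : D.Point}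
    (h : D.Joined x y) (hx : x.1 = (k, j)) (hy : y.1 = (k', j')) :
    colorAt γ k j = colorAt γ k' j' := by
  rw [colorAt_eq γ x hx, colorAt_eq γ y hy]
  exact congrArg γ (Quotient.sound (Relation.EqvGen.rel _ _ h))

theorem range_map_eq (g : ℕ → ℤ) (a b c : ℕ) :
    (List.range (a + b + c)).map g = (List.range a).map g ++
      ((List.range b).map (fun j => g (a + j)) ++ (List.range c).map fun j => g (a + b + j)) := by
  simp [List.range_add, Function.comp_def]

/-- The properties of the coloured slices of a coloured diagram. -/
def IsColoredBy (γ : D.Arc → ℤ) (s : CSlice) : Prop :=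
  (∀ x ∈ s.core.bot ++ s.core.top, ∃ A, γ A = x) ∧
    ∀ b a o, s.core = .cross b a o →
      ∃ A B C, D.IsCrossing A B C ∧ γ A = a ∧ γ B = o ∧ γ C = 2 * a - o

/-- The colours below the crossing determine those above: the over strand keeps its colour because
its ends lie on one arc, and the other under arc is given by the crossing relation. -/
theorem exists_core {γ : D.Arc → ℤ} (hγ : D.IsColoring γ) {k : ℕ} {s : Slice}
    (hs : D.slices[k]? = some s) :
    ∃ c : Core, c.piece = s.piece ∧
      c.bot = (List.range s.piece.ins).map (fun j => colorAt γ k (s.pos + j)) ∧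
      c.top = (List.range s.piece.outs).map (fun j => colorAt γ (k + 1) (s.pos + j)) ∧
      ∀ b a o, c = .cross b a o →
        ∃ A B C, D.IsCrossing A B C ∧ γ A = a ∧ γ B = o ∧ γ C = 2 * a - o := by
  have hk : k + 1 ≤ D.slices.length := (List.getElem?_eq_some_iff.1 hs).1
  have h1 := D.pos_add_ins_le hs
  have h2 := D.strands_succ hs
  obtain ⟨p, i⟩ := s
  cases p with
  | cup =>
    simp only [Piece.ins, Piece.outs] at h1 h2
    obtain ⟨x, hx⟩ := exists_point (D := D) hk (j := i) (by omega)
    obtain ⟨y, hy⟩ := exists_point (D := D) hk (j := i + 1) (by omega)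
    refine ⟨.cup (colorAt γ (k + 1) i), rfl, rfl, ?_, by simp⟩
    simp [Core.top, Piece.outs, List.range_succ,
      colorAt_eq_of_joined γ (.cup k i x y hs hx hy) hx hy]
  | cap =>
    simp only [Piece.ins, Piece.outs] at h1 h2
    obtain ⟨x, hx⟩ := exists_point (D := D) (k := k) (by omega) (j := i) (by omega)
    obtain ⟨y, hy⟩ := exists_point (D := D) (k := k) (by omega) (j := i + 1) (by omega)
    refine ⟨.cap (colorAt γ k i), rfl, ?_, rfl, by simp⟩
    simp [Core.bot, Piece.ins, List.range_succ,
      colorAt_eq_of_joined γ (.cap k i x y hs hx hy) hx hy]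
  | cross b =>
    simp only [Piece.ins, Piece.outs] at h1 h2
    obtain ⟨x, hx⟩ := exists_point (D := D) (k := k) (by omega) (j := i) (by omega)
    obtain ⟨y, hy⟩ := exists_point (D := D) (k := k) (by omega) (j := i + 1) (by omega)
    obtain ⟨x', hx'⟩ := exists_point (D := D) hk (j := i) (by omega)
    obtain ⟨y', hy'⟩ := exists_point (D := D) hk (j := i + 1) (by omega)
    cases b with
    | true =>
      have hc : D.IsCrossing (D.arc x) (D.arc y) (D.arc x') :=
        ⟨k, i, x, y, x', rfl, rfl, rfl, .inl ⟨hs, hx, hy, hx'⟩⟩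
      have e := hγ _ _ _ hc
      have e' := colorAt_eq_of_joined γ (.over_true k i x y' hs hx hy') hx hy'
      have e'' : colorAt γ (k + 1) i = 2 * colorAt γ k i - colorAt γ k (i + 1) := by
        rw [colorAt_eq γ x hx, colorAt_eq γ y hy, colorAt_eq γ x' hx']
        omega
      refine ⟨.cross true (colorAt γ k i) (colorAt γ k (i + 1)), rfl, ?_, ?_, ?_⟩
      · simp [Core.bot, Piece.ins, List.range_succ]
      · simp [Core.top, Piece.outs, List.range_succ, ← e', e'']
      · rintro b a o ⟨⟩
        exact ⟨_, _, _, hc, (colorAt_eq γ x hx).symm, (colorAt_eq γ y hy).symm, by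
          rw [← e'', colorAt_eq γ x' hx']⟩
    | false =>
      have hc : D.IsCrossing (D.arc y) (D.arc x) (D.arc y') :=
        ⟨k, i, y, x, y', rfl, rfl, rfl, .inr ⟨hs, hy, hx, hy'⟩⟩
      have e := hγ _ _ _ hc
      have e' := colorAt_eq_of_joined γ (.over_false k i y x' hs hy hx') hy hx'
      have e'' : colorAt γ (k + 1) (i + 1) = 2 * colorAt γ k (i + 1) - colorAt γ k i := by
        rw [colorAt_eq γ x hx, colorAt_eq γ y hy, colorAt_eq γ y' hy']
        omega
      refine ⟨.cross false (colorAt γ k (i + 1)) (colorAt γ k i), rfl, ?_, ?_, ?_⟩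
      · simp [Core.bot, Piece.ins, List.range_succ]
      · simp [Core.top, Piece.outs, List.range_succ, ← e', e'']
      · rintro b a o ⟨⟩
        exact ⟨_, _, _, hc, (colorAt_eq γ y hy).symm, (colorAt_eq γ x hx).symm, by
          rw [← e'', colorAt_eq γ y' hy']⟩

theorem exists_arc_of_mem_colors {γ : D.Arc → ℤ} {k : ℕ} (hk : k ≤ D.slices.length) {x : ℤ}
    (hx : x ∈ colors γ k) : ∃ A, γ A = x := by
  obtain ⟨j, hj, rfl⟩ := List.mem_map.1 hx
  obtain ⟨y, hy⟩ := exists_point hk (List.mem_range.1 hj)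
  exact ⟨_, (colorAt_eq γ y hy).symm⟩

theorem exists_cslice {γ : D.Arc → ℤ} (hγ : D.IsColoring γ) {k : ℕ} {s : Slice}
    (hs : D.slices[k]? = some s) :
    ∃ c : CSlice, c.slice = s ∧ c.bot = colors γ k ∧ c.top = colors γ (k + 1) ∧
      IsColoredBy γ c := by
  have hk : k + 1 ≤ D.slices.length := (List.getElem?_eq_some_iff.1 hs).1
  have h1 := D.pos_add_ins_le hs
  have h2 := D.strands_succ hs
  obtain ⟨c, hc1, hc2, hc3, hc4⟩ := exists_core hγ hs
  let e := D.strands k - (s.pos + s.piece.ins)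
  let C : CSlice := ⟨(List.range s.pos).map (colorAt γ k), c,
    (List.range e).map fun j => colorAt γ k (s.pos + s.piece.ins + j)⟩
  have hbot : C.bot = colors γ k := by
    rw [colors, show D.strands k = s.pos + s.piece.ins + e by omega, range_map_eq, ← hc2]
    rfl
  have htop : C.top = colors γ (k + 1) := by
    rw [colors, show D.strands (k + 1) = s.pos + s.piece.outs + e by omega, range_map_eq, ← hc3]
    refine congrArg₂ _ ?_ (congrArg _ ?_)
    · refine List.map_congr_left fun j hj => ?_
      have hj := List.mem_range.1 hj
      obtain ⟨x, hx⟩ := exists_point (D := D) (k := k) (by omega) (j := j) (by omega)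
      obtain ⟨y, hy⟩ := exists_point (D := D) hk (j := j) (by omega)
      exact colorAt_eq_of_joined γ (.left k j s x y hs hj hx hy) hx hy
    · refine List.map_congr_left fun j hj => ?_
      have hj := List.mem_range.1 hj
      obtain ⟨x, hx⟩ := exists_point (D := D) (k := k) (by omega)
        (j := s.pos + s.piece.ins + j) (by omega)
      obtain ⟨y, hy⟩ := exists_point (D := D) hk (j := s.pos + s.piece.outs + j) (by omega)
      exact colorAt_eq_of_joined γ (.right k j s x y hs hx hy) hx hy
  refine ⟨C, ?_, hbot, htop, ?_, hc4⟩
  · simp [C, CSlice.slice, hc1]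
  · intro x hx
    obtain hx | hx := List.mem_append.1 hx
    · exact exists_arc_of_mem_colors (k := k) (by omega) (hbot ▸ by simp [CSlice.bot, hx])
    · exact exists_arc_of_mem_colors (k := k + 1) hk (htop ▸ by simp [CSlice.top, hx])

/-- A coloured diagram is a coloured word. -/
theorem exists_colored_word {γ : D.Arc → ℤ} (hγ : D.IsColoring γ) :
    ∃ W : List CSlice, D.slices = word W ∧ Chain W [] [] ∧ (∀ s ∈ W, IsColoredBy γ s) ∧
      ∀ A, ∃ s ∈ W, γ A ∈ s.core.bot ++ s.core.top := by
  -- Every strand starts at the top of some piece. Keeping track of this for all lower levels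
  -- ensures in the end that the colour of every arc occurs at a piece.
  have key : ∀ k ≤ D.slices.length, ∃ W : List CSlice, D.slices.take k = word W ∧
      Chain W [] (colors γ k) ∧ (∀ s ∈ W, IsColoredBy γ s) ∧
      ∀ k' ≤ k, ∀ x ∈ colors γ k', ∃ s ∈ W, x ∈ s.core.top := by
    intro k
    induction k with
    | zero =>
      refine fun _ => ⟨[], rfl, rfl, by simp, fun k' hk' x hx => ?_⟩
      obtain rfl := Nat.le_zero.1 hk'
      simp [colors, strands_zero] at hx
    | succ k ih =>
      intro hk
      obtain ⟨W, h1, h2, h3, h4⟩ := ih (by omega)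
      have hs : D.slices[k]? = some D.slices[k] := List.getElem?_eq_getElem hk
      obtain ⟨c, hc1, hc2, hc3, hc4⟩ := exists_cslice hγ hs
      have hchain : Chain (W ++ [c]) [] (colors γ (k + 1)) := h2.append ⟨hc2.symm, hc3⟩
      refine ⟨W ++ [c], ?_, hchain, ?_, fun k' hk' x hx => ?_⟩
      · rw [D.take_succ_eq hs, h1, word_append, word_cons, hc1, word_nil]
      · intro s hs
        obtain hs | hs := List.mem_append.1 hs
        · exact h3 s hs
        · rwa [List.mem_singleton.1 hs]
      · obtain hk' | rfl := Nat.le_succ_iff.1 hk'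
        · obtain ⟨s, hs, h⟩ := h4 k' hk' x hx
          exact ⟨s, by simp [hs], h⟩
        · exact hchain.exists_mem_top hx
  obtain ⟨W, h1, h2, h3, h4⟩ := key _ le_rfl
  rw [List.take_length] at h1
  refine ⟨W, h1, ?_, h3, fun A => ?_⟩
  · simpa [colors, strands_length] using h2
  · induction A using Quotient.inductionOn with
    | _ x =>
      obtain ⟨⟨k, j⟩, hk, hj⟩ := x
      obtain ⟨s, hs, h⟩ := h4 k hk (γ (D.arc ⟨(k, j), hk, hj⟩))
        (List.mem_map.2 ⟨j, List.mem_range.2 hj, colorAt_eq γ _ rfl⟩)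
      exact ⟨s, hs, List.mem_append.2 (.inr h)⟩

end Diagram

/-! ### Colourings from coloured words -/

/-- The colours above the first `k` slices of a coloured word. -/
def levelColors : List CSlice → List ℤ → ℕ → List ℤ
  | _, c, 0 => c
  | [], c, _ + 1 => c
  | s :: W, _, k + 1 => levelColors W s.top k

theorem Chain.levelColors_eq {W : List CSlice} {c d : List ℤ} (h : Chain W c d) {k : ℕ}
    {s : CSlice} (hs : W[k]? = some s) :
    levelColors W c k = s.bot ∧ levelColors W c (k + 1) = s.top := by
  induction W generalizing c k with
  | nil => simp at hs
  | cons t W ih =>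
    obtain ⟨rfl, h⟩ := h
    cases k with
    | zero =>
      obtain rfl : t = s := by simpa using hs
      exact ⟨rfl, by simp [levelColors]⟩
    | succ k => exact ih h (by simpa using hs)

theorem mem_levelColors {P : ℤ → Prop} {W : List CSlice} {c : List ℤ} {k : ℕ}
    (hc : ∀ x ∈ c, P x) (hW : Chain W c []) (hP : ∀ s ∈ W, ∀ x ∈ s.core.top, P x) :
    ∀ x ∈ levelColors W c k, P x := by
  induction W generalizing c k with
  | nil => cases k <;> exact hc
  | cons s W ih =>
    obtain ⟨rfl, hW⟩ := hW
    cases k with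
    | zero => exact hc
    | succ k =>
      refine ih (fun x hx => ?_) hW fun t ht => hP t (by simp [ht])
      simp only [CSlice.top, List.mem_append] at hx
      obtain hx | hx | hx := hx
      · exact hc x (by simp [CSlice.bot, hx])
      · exact hP s (by simp) x hx
      · exact hc x (by simp [CSlice.bot, hx])

theorem length_levelColors {W : List CSlice} {c d : List ℤ} (h : Chain W c d) (k : ℕ) :
    (levelColors W c k).length = strandsAfter ((word W).take k) c.length := by
  induction W generalizing c k with
  | nil => cases k <;> rfl
  | cons s W ih =>
    obtain ⟨rfl, h⟩ := h
    cases k with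
    | zero => rfl
    | succ k =>
      rw [levelColors, ih h, word_cons, List.take_succ_cons, strandsAfter]
      congr 1
      simp only [CSlice.bot, CSlice.top, CSlice.slice, List.length_append, Core.length_bot,
        Core.length_top]
      omega

theorem getD_append_add (l r : List ℤ) (j : ℕ) : (l ++ r).getD (l.length + j) 0 = r.getD j 0 := by
  rw [List.getD_eq_getElem?_getD, List.getElem?_append_right (by omega)]
  simp [List.getD_eq_getElem?_getD]

theorem getD_append_left (l r : List ℤ) {j : ℕ} (hj : j < l.length) :
    (l ++ r).getD j 0 = l.getD j 0 := by
  simp [List.getD_eq_getElem?_getD, List.getElem?_append_left hj]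

/-- The colour of a point of a coloured word. -/
def levelColor (W : List CSlice) (x : ℕ × ℕ) : ℤ := (levelColors W [] x.1).getD x.2 0

theorem Chain.levelColor_eq {D : Diagram} {W : List CSlice} (h : Chain W [] [])
    (hD : D.slices = word W) {k : ℕ} {s : Slice} (hs : D.slices[k]? = some s) :
    ∃ c ∈ W, c.slice = s ∧
      (∀ j, levelColor W (k, s.pos + j) = (c.core.bot ++ c.r).getD j 0) ∧
      (∀ j, levelColor W (k + 1, s.pos + j) = (c.core.top ++ c.r).getD j 0) ∧
      ∀ j < s.pos, levelColor W (k, j) = levelColor W (k + 1, j) := by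
  rw [hD, word, List.getElem?_map] at hs
  obtain ⟨c, hc, rfl⟩ := Option.map_eq_some_iff.1 hs
  obtain ⟨h1, h2⟩ := h.levelColors_eq hc
  refine ⟨c, List.mem_of_getElem? hc, rfl, fun j => ?_, fun j => ?_, fun j hj => ?_⟩
  · rw [levelColor, h1]
    exact getD_append_add _ _ _
  · rw [levelColor, h2]
    exact getD_append_add _ _ _
  · rw [levelColor, levelColor, h1, h2]
    exact (getD_append_left _ _ hj).trans (getD_append_left _ _ hj).symm

theorem Chain.levelColor_joined {D : Diagram} {W : List CSlice} (h : Chain W [] [])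
    (hD : D.slices = word W) {x y : D.Point} (hxy : D.Joined x y) :
    levelColor W x.1 = levelColor W y.1 := by
  cases hxy with
  | left k j s x y hs hj hx hy =>
    obtain ⟨c, -, -, -, -, h3⟩ := h.levelColor_eq hD hs
    rw [hx, hy, h3 j hj]
  | right k j s x y hs hx hy =>
    obtain ⟨c, -, rfl, h1, h2, -⟩ := h.levelColor_eq hD hs
    rw [hx, hy, add_assoc, add_assoc, h1, h2]
    have e1 := getD_append_add c.core.bot c.r j
    have e2 := getD_append_add c.core.top c.r j
    rw [Core.length_bot] at e1
    rw [Core.length_top] at e2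
    exact e1.trans e2.symm
  | cup k i x y hs hx hy =>
    obtain ⟨⟨l, c, r⟩, -, hc, -, h2, -⟩ := h.levelColor_eq hD hs
    have h20 := h2 0
    have h21 := h2 1
    rw [hx, hy]
    rcases c with x | x | ⟨_ | _, a, o⟩ <;> simp_all [CSlice.slice, Core.piece, Core.top]
  | cap k i x y hs hx hy =>
    obtain ⟨⟨l, c, r⟩, -, hc, h1, -, -⟩ := h.levelColor_eq hD hs
    have h10 := h1 0
    have h11 := h1 1
    rw [hx, hy]
    rcases c with x | x | ⟨_ | _, a, o⟩ <;> simp_all [CSlice.slice, Core.piece, Core.bot]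
  | over_true k i x y hs hx hy =>
    obtain ⟨⟨l, c, r⟩, -, hc, h1, h2, -⟩ := h.levelColor_eq hD hs
    have h10 := h1 0
    have h21 := h2 1
    rw [hx, hy]
    rcases c with x | x | ⟨_ | _, a, o⟩ <;> simp_all [CSlice.slice, Core.piece, Core.bot, Core.top]
  | over_false k i x y hs hx hy =>
    obtain ⟨⟨l, c, r⟩, -, hc, h1, h2, -⟩ := h.levelColor_eq hD hs
    have h11 := h1 1
    have h20 := h2 0
    rw [hx, hy]
    rcases c with x | x | ⟨_ | _, a, o⟩ <;> simp_all [CSlice.slice, Core.piece, Core.bot, Core.top]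

/-- A coloured word is a coloured diagram. -/
theorem Chain.exists_coloring {D : Diagram} {W : List CSlice} (h : Chain W [] [])
    (hD : D.slices = word W) {P : ℤ → Prop} (hP : ∀ s ∈ W, ∀ x ∈ s.core.top, P x)
    (hp : IsPolychromatic W) :
    ∃ γ : D.Arc → ℤ, D.IsNontrivialColoring γ ∧ ∀ A, P (γ A) := by
  -- The colour of a point is constant along strands that do not pass under another one, hence well
  -- defined on arcs.
  let γ : D.Arc → ℤ := Quotient.lift (fun x : D.Point => levelColor W x.1) fun x y hxy => by
    change Relation.EqvGen _ x y at hxy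
    induction hxy with
    | rel x y hxy => exact h.levelColor_joined hD hxy
    | refl x => rfl
    | symm x y _ ih => exact ih.symm
    | trans x y z _ _ ih ih' => exact ih.trans ih'
  have hγ : ∀ x, γ (D.arc x) = levelColor W x.1 := fun x => rfl
  refine ⟨γ, ⟨?_, ?_⟩, ?_⟩
  · rintro _ _ _ ⟨k, i, x, y, z, rfl, rfl, rfl, ⟨hs, hx, hy, hz⟩ | ⟨hs, hx, hy, hz⟩⟩
    · obtain ⟨⟨l, c, r⟩, -, hc, h1, h2, -⟩ := h.levelColor_eq hD hs
      have h10 := h1 0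
      have h11 := h1 1
      have h20 := h2 0
      rw [hγ, hγ, hγ, hx, hy, hz]
      rcases c with x | x | ⟨_ | _, a, o⟩ <;>
        simp_all [CSlice.slice, Core.piece, Core.bot, Core.top]
    · obtain ⟨⟨l, c, r⟩, -, hc, h1, h2, -⟩ := h.levelColor_eq hD hs
      have h10 := h1 0
      have h11 := h1 1
      have h21 := h2 1
      rw [hγ, hγ, hγ, hx, hy, hz]
      rcases c with x | x | ⟨_ | _, a, o⟩ <;>
        simp_all [CSlice.slice, Core.piece, Core.bot, Core.top]
  -- The two strands that enter a crossing with at least two colours have different colours.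
  · obtain ⟨⟨l, c, r⟩, hs, b, a, o, hc, hao⟩ := hp
    simp only at hc
    subst hc
    obtain ⟨k, hk⟩ := List.mem_iff_getElem?.1 hs
    have hsl : D.slices[k]? = some ⟨.cross b, l.length⟩ := by
      rw [hD, word, List.getElem?_map, hk]
      rfl
    have hkl : k < D.slices.length := (List.getElem?_eq_some_iff.1 hsl).1
    have hpos := D.pos_add_ins_le hsl
    simp only [Piece.ins] at hpos
    obtain ⟨x, hx⟩ := Diagram.exists_point (D := D) hkl.le (j := l.length) (by omega)
    obtain ⟨y, hy⟩ := Diagram.exists_point (D := D) hkl.le (j := l.length + 1) (by omega)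
    refine ⟨D.arc x, D.arc y, ?_⟩
    rw [hγ, hγ, hx, hy, levelColor, levelColor, (h.levelColors_eq hk).1]
    have e0 := getD_append_add l ((Core.cross b a o).bot ++ r) 0
    have e1 := getD_append_add l ((Core.cross b a o).bot ++ r) 1
    rw [add_zero] at e0
    rw [CSlice.bot, e0, e1]
    cases b <;> simp [Core.bot, hao, hao.symm]
  · intro A
    induction A using Quotient.inductionOn with
    | _ x =>
      obtain ⟨⟨k, j⟩, hk, hj⟩ := x
      refine mem_levelColors (W := W) (c := []) (k := k) (by simp) h hP _ ?_
      -- The index is in range at a point of the diagram, so the default value `0` of `getD` is not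
      -- used.
      have hl : j < (levelColors W [] k).length := by
        rw [length_levelColors h, ← hD]
        exact hj
      change (levelColors W [] k).getD j 0 ∈ _
      rw [List.getD_eq_getElem _ _ hl]
      exact List.getElem_mem hl

/-! ### The minimal colouring number -/

/-- The lower bound: a non-trivial colouring of a diagram of a link that is not splittable has at
least four colours. -/
theorem four_le_ncard {D : Diagram} (hD : ¬ D.link.IsSplittable) {γ : D.Arc → ℤ}
    (hγ : D.IsNontrivialColoring γ) : 4 ≤ (Set.range γ).ncard := by
  obtain ⟨hγ, A₀, B₀, hne⟩ := hγ
  by_contra! hlt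
  obtain ⟨W, hDW, hW, hWγ, hmem⟩ := Diagram.exists_colored_word hγ
  have : Nonempty D.Arc := ⟨A₀⟩
  obtain ⟨Amin, hmin⟩ := Finite.exists_min γ
  obtain ⟨Amax, hmax⟩ := Finite.exists_max γ
  have hlt' : γ Amin < γ Amax := by
    have := hmin A₀
    have := hmin B₀
    have := hmax A₀
    have := hmax B₀
    omega
  -- The splitting criterion, with the relation between the three colours as the only information
  -- about a crossing.
  have split : ∀ (χ : ℤ → Bool) (A B : D.Arc), χ (γ A) = true → χ (γ B) = false →
      (∀ A B C, 2 * γ A = γ B + γ C → χ (γ C) = χ (γ B) ∧ (χ (γ A) ≠ χ (γ B) → χ (γ A) = true)) →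
      False := by
    intro χ A B hA hB h
    obtain ⟨s, hs, hsA⟩ := hmem A
    obtain ⟨t, ht, htB⟩ := hmem B
    refine hD (hW.isSplittable χ hDW (fun u hu b a o hc => ?_) ⟨s, hs, _, hsA, hA⟩
      ⟨t, ht, _, htB, hB⟩)
    obtain ⟨A, B, C, hABC, rfl, rfl, hC⟩ := (hWγ u hu).2 b a o hc
    rw [← hC]
    exact h A B C (hγ A B C hABC)
  by_cases hmid : ∃ A, γ A ≠ γ Amin ∧ γ A ≠ γ Amax
  · obtain ⟨M, hM, hM'⟩ := hmid
    have hall : ∀ A, γ A = γ Amin ∨ γ A = γ M ∨ γ A = γ Amax := by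
      by_contra! hA
      obtain ⟨A, h1, h2, h3⟩ := hA
      have hsub : ({γ Amin, γ M, γ Amax, γ A} : Finset ℤ) ≤ (Set.finite_range γ).toFinset := by
        intro x hx
        simp only [Finset.mem_insert, Finset.mem_singleton] at hx
        obtain rfl | rfl | rfl | rfl := hx <;> simp
      have hcard := Finset.card_le_card hsub
      rw [← Set.ncard_eq_toFinset_card _ (Set.finite_range γ)] at hcard
      have : ({γ Amin, γ M, γ Amax, γ A} : Finset ℤ).card = 4 := by
        rw [Finset.card_insert_of_notMem, Finset.card_insert_of_notMem,
          Finset.card_insert_of_notMem, Finset.card_singleton] <;>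
          simp only [Finset.mem_insert, Finset.mem_singleton] <;> omega
      omega
    -- The over arc of a crossing that is not monochromatic has the middle colour, and then its
    -- under arcs have the least and the greatest colour.
    refine split (fun x => decide (x = γ M)) M Amin (by simp) (by simpa using hM.symm) ?_
    intro A B C h
    have := hall A
    have := hall B
    have := hall C
    have := hmin B
    have := hmin C
    have := hmax B
    have := hmax C
    simp only [decide_eq_decide, ne_eq, decide_eq_true_eq]
    omega
  · have hall : ∀ A, γ A = γ Amin ∨ γ A = γ Amax := by
      intro A
      by_contra! hA
      exact hmid ⟨A, hA⟩
    -- With only two colours every crossing is monochromatic.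
    refine split (fun x => decide (x = γ Amin)) Amin Amax (by simp) (by simpa using hlt'.ne') ?_
    intro A B C h
    have := hall A
    have := hall B
    have := hall C
    have := hmin B
    have := hmin C
    have := hmax B
    have := hmax C
    simp only [decide_eq_decide, ne_eq, decide_eq_true_eq]
    omega

/-- If the colours at each crossing are congruent modulo `d` and the link is not splittable, then all
colours are congruent modulo `d`. -/
theorem dvd_sub_of_dvd_crossings {D : Diagram} (hD : ¬ D.link.IsSplittable) {γ : D.Arc → ℤ}
    (hγ : D.IsColoring γ) {d : ℤ} (h : ∀ A B C, D.IsCrossing A B C → d ∣ γ A - γ B)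
    (A B : D.Arc) : d ∣ γ B - γ A := by
  obtain ⟨W, hDW, hW, hWγ, hmem⟩ := Diagram.exists_colored_word hγ
  by_contra hAB
  obtain ⟨s, hs, hsA⟩ := hmem A
  obtain ⟨t, ht, htB⟩ := hmem B
  -- All arcs at a crossing are in the same residue class, so no crossing involves both labels.
  refine hD (hW.isSplittable (fun x => decide (d ∣ x - γ A)) hDW (fun u hu b a o hc => ?_)
    ⟨s, hs, _, hsA, by simp⟩ ⟨t, ht, _, htB, by simpa using hAB⟩)
  obtain ⟨A', B', C', hABC, rfl, rfl, hC⟩ := (hWγ u hu).2 b a o hc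
  have h1 := h _ _ _ hABC
  have h2 : d ∣ γ A' - γ A ↔ d ∣ γ B' - γ A := by
    rw [← sub_add_sub_cancel (γ A') (γ B') (γ A)]
    exact dvd_add_right h1
  have h3 : d ∣ 2 * γ A' - γ B' - γ A ↔ d ∣ γ B' - γ A := by
    rw [← h2, show 2 * γ A' - γ B' - γ A = γ A' - γ B' + (γ A' - γ A) by ring]
    exact dvd_add_right h1
  simp [h2, h3]

/-- A simple colouring can be normalised: the least colour is `0`, and the colours at a crossing
differ by at most `1`. -/
theorem exists_isSimple_word {D : Diagram} (hD : ¬ D.link.IsSplittable) {γ : D.Arc → ℤ}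
    (h : D.IsSimpleColoring γ) :
    ∃ (n : ℕ) (W : List CSlice), Chain W [] [] ∧ D.slices = word W ∧
      (∀ s ∈ W, s.core.IsSimple n) ∧ IsPolychromatic W := by
  obtain ⟨⟨hγ, A₀, B₀, hne⟩, d, hd⟩ := h
  have : Nonempty D.Arc := ⟨A₀⟩
  obtain ⟨Amin, hmin⟩ := Finite.exists_min γ
  have hdiff : ∀ A B C, D.IsCrossing A B C →
      (γ A - γ B = d ∨ γ A - γ B = -d ∨ γ A - γ B = 0) := by
    intro A B C hABC
    obtain ⟨h | h, -⟩ := hd A B C hABC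
    · obtain h | h := abs_eq_abs.1 (h.trans (Nat.abs_cast d).symm)
      · exact .inl h
      · exact .inr (.inl h)
    · exact .inr (.inr (abs_eq_zero.1 h))
  have hdvd : ∀ A, (d : ℤ) ∣ γ A - γ Amin := by
    refine fun A => dvd_sub_of_dvd_crossings hD hγ (fun A B C hABC => ?_) Amin A
    obtain h | h | h := hdiff A B C hABC <;> simp [h]
  choose δ hδ using hdvd
  -- If `d` were `0`, all colours would equal the least one, and the colouring would be trivial.
  have hd0 : 0 < (d : ℤ) := by
    by_contra! h0
    obtain h0 : (d : ℤ) = 0 := by omega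
    have h1 := hδ A₀
    have h2 := hδ B₀
    rw [h0, zero_mul] at h1 h2
    omega
  have hδcol : D.IsColoring δ := by
    intro A B C hABC
    have h1 := hγ A B C hABC
    have h2 := hδ A
    have h3 := hδ B
    have h4 := hδ C
    refine mul_left_cancel₀ hd0.ne' ?_
    linarith
  obtain ⟨W, hDW, hW, hWδ, hmem⟩ := Diagram.exists_colored_word hδcol
  have hδpos : ∀ A, 0 ≤ δ A := by
    intro A
    have h1 := hmin A
    have h2 := hδ A
    by_contra! h3
    have := mul_neg_of_pos_of_neg hd0 h3
    omega
  obtain ⟨Amax, hmax⟩ := Finite.exists_max δ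
  obtain ⟨n, hn⟩ := Int.eq_ofNat_of_zero_le (hδpos Amax)
  have hδdiff : ∀ A B C, D.IsCrossing A B C → δ A - δ B ≤ 1 ∧ δ B - δ A ≤ 1 := by
    intro A B C hABC
    have h1 := hdiff A B C hABC
    have h2 := hδ A
    have h3 := hδ B
    have h4 : (d : ℤ) * (δ A - δ B) = γ A - γ B := by rw [mul_sub]; omega
    constructor <;> by_contra! h5
    · have := mul_lt_mul_of_pos_left h5 hd0
      omega
    · have h6 : δ A - δ B < -1 := by omega
      have := mul_lt_mul_of_pos_left h6 hd0
      omega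
  refine ⟨n, W, hW, hDW, fun s hs => ?_, ?_⟩
  · obtain ⟨h1, h2⟩ := hWδ s hs
    have hb : ∀ x ∈ s.core.bot ++ s.core.top, 0 ≤ x ∧ x ≤ n := by
      intro x hx
      obtain ⟨A, rfl⟩ := h1 x hx
      exact ⟨hδpos A, hn ▸ hmax A⟩
    obtain ⟨l, k, r⟩ := s
    cases k with
    | cup x => exact hb x (by simp [Core.top])
    | cap x => exact hb x (by simp [Core.bot])
    | cross b a o =>
      obtain ⟨A, B, C, hABC, hA, hB, hC⟩ := h2 b a o rfl
      have h3 := hδdiff A B C hABC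
      rw [hA, hB] at h3
      exact ⟨hb a (by cases b <;> simp [Core.bot]), hb o (by cases b <;> simp [Core.bot]),
        hb _ (by cases b <;> simp [Core.top]), h3⟩
  · by_contra hp
    have hAB : δ A₀ ≠ δ B₀ := by
      intro h
      have h1 := hδ A₀
      have h2 := hδ B₀
      rw [h] at h1
      omega
    obtain ⟨s, hs, hsA⟩ := hmem A₀
    obtain ⟨t, ht, htB⟩ := hmem B₀
    -- If every crossing were monochromatic, the strands of the colour `δ A₀` would meet no others.
    refine hD (hW.isSplittable (fun x => decide (x = δ A₀)) hDW (fun u hu b a o hc => ?_)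
      ⟨s, hs, _, hsA, by simp⟩ ⟨t, ht, _, htB, by simpa using hAB.symm⟩)
    obtain rfl : a = o := by
      by_contra hao
      exact hp ⟨u, hu, b, a, o, hc, hao⟩
    simp [two_mul]

end ZColoring

theorem theorem4p2 (L : ZColoring.Link) (hsplit : ¬ L.IsSplittable) (hcol : L.IsZColorable)
    (hsimple : ∃ D : ZColoring.Diagram, D.link = L ∧ ∃ γ : D.Arc → ℤ, D.IsSimpleColoring γ) :
    L.mincol = 4 := by
  obtain ⟨D, rfl, γ, hγ⟩ := hsimple
  obtain ⟨n, W, hW, hDW, hs, hp⟩ := ZColoring.exists_isSimple_word hsplit hγ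
  obtain ⟨E, V, hE, hV, hEV, hs', hp'⟩ := ZColoring.exists_isSimple_three n hsplit hW hDW hs hp
  -- Only the range of the colours is needed from here on: `0, …, 3` leaves at most four values.
  obtain ⟨δ, hδ, hδ'⟩ := hV.exists_coloring hEV (P := fun x => x ∈ Set.Icc 0 3)
    (fun s h x hx => by
      have h1 := hs' s h
      obtain ⟨l, k, r⟩ := s
      rcases k with y | y | ⟨_ | _, a, o⟩ <;>
        simp only [ZColoring.Core.top, ZColoring.Core.IsSimple, List.mem_cons, List.not_mem_nil,
          or_false, Set.mem_Icc] at h1 hx ⊢ <;> omega) hp'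
  have hcard : (Set.range δ).ncard ≤ 4 := by
    have h1 : Set.range δ ⊆ (Finset.Icc (0 : ℤ) 3 : Finset ℤ) := by
      rintro _ ⟨A, rfl⟩
      simpa using hδ' A
    have h2 := Set.ncard_le_ncard h1 (Finset.finite_toSet _)
    rwa [Set.ncard_coe_finset] at h2
  have hmem : (Set.range δ).ncard ∈ {n : ℕ | ∃ F : ZColoring.Diagram, F.link = D.link ∧
      ∃ ε : F.Arc → ℤ, F.IsNontrivialColoring ε ∧ n = (Set.range ε).ncard} :=
    ⟨E, hE, δ, hδ, rfl⟩
  refine le_antisymm ((Nat.sInf_le hmem).trans hcard) (le_csInf ⟨_, hmem⟩ ?_)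
  rintro _ ⟨F, hF, ε, hε, rfl⟩
  exact ZColoring.four_le_ncard (by rwa [hF]) hε
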